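/- **Claim 4.8.** Let $H$ be a real Hilbert space and let $F:H\to H$ be defined on all of $H$, monotone ($\langle F(u)-F(v),u-v\rangle\ge 0$ for all $u,v\in H$) and hemicontinuous ($F(x+sv)\rightharpoonup F(x)$ weakly as $s\to 0$, for all $x,v\in H$). Let $y$ be a zero of $F$ of minimal norm: $F(y)=0$ and $\|y\|\le\|z\|$ whenever $F(z)=0$. Let $\varepsilon:[0,\infty)\to(0,\infty)$ be continuous, nonincreasing, differentiable on $(0,\infty)$, with $\lim_{t\to\infty}\varepsilon(t)=0$ and $\lim_{t\to\infty}\varepsilon'(t)/\varepsilon(t)^2=0$. Let $u_0\in H$ be arbitrary. A solution of the Cauchy problem $$u'(t)=-F(u(t))-\varepsilon(t)u(t),\qquad u(0)=u_0, \qquad (*)$$ on an interval $J=[0,T)$, $0<T\le\infty$, is a norm-continuous $u:J\to H$ with $u(0)=u_0$ such that the equation holds at every $t\in J$ with $u'$ the derivative in the weak topology of $H$ (one-sided at $t=0$). Then $(*)$ has a solution $u$ on $[0,\infty)$, and every solution of $(*)$ on an interval $[0,T)$, $0<T<\infty$, is the restriction of $u$ to $[0,T)$ (so $u$ is the unique global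 solution). The equation also holds in the norm sense: at every $t\ge 0$ with $u'$ the right derivative, and at almost every $t\ge 0$ with $u'$ the two-sided derivative. Moreover $\lim_{t\to\infty}\|u(t)-y\|=0$; in particular the limit $u(\infty)$ exists and $F(u(\infty))=0$. -/

import Mathlib

open Set Filter Topology MeasureTheory
open scoped RealInnerProductSpace

namespace DSM

variable {H : Type*} [NormedAddCommGroup H] [InnerProductSpace ℝ H]

/-- `F : H → H` is monotone. -/
def IsMonotone (F : H → H) : Prop :=
  ∀ u v : H, 0 ≤ ⟪F u - F v, u - v⟫

/-- `F : H → H` is hemicontinuous: it is continuous along lines, into `H` with its weak topology,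
that is, `F (x + t v) ⇀ F x` weakly as `t → 0`. -/
def IsHemicontinuous (F : H → H) : Prop :=
  ∀ x v z : H, Tendsto (fun t : ℝ => ⟪F (x + t • v), z⟫) (𝓝 0) (𝓝 ⟪F x, z⟫)

/-- `y` is a zero of `F` of minimal norm. -/
def IsMinimalNormZero (F : H → H) (y : H) : Prop :=
  F y = 0 ∧ ∀ z : H, F z = 0 → ‖y‖ ≤ ‖z‖

/-- The right-hand side `Φ(t, u) = -F(u) - ε(t) u`. -/
def Phi (F : H → H) (ε : ℝ → ℝ) (t : ℝ) (u : H) : H :=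
  -F u - ε t • u

/-- `u` solves `u' = Φ(t, u)`, `u(0) = u₀` on the time interval `J`: it is norm continuous and the
equation holds at every time of `J`, the derivative being taken in the weak topology of `H`
(and one-sided at an end point of `J`). -/
structure IsSolutionOn (Φ : ℝ → H → H) (u₀ : H) (J : Set ℝ) (u : ℝ → H) : Prop where
  continuousOn : ContinuousOn u J
  initial : u 0 = u₀
  weakDeriv : ∀ t ∈ J, ∀ z : H,
    HasDerivWithinAt (fun s => ⟪u s, z⟫) ⟪Φ t (u t), z⟫ J t

end DSM

/-! The right-hand side `-F - ε` is dissipative, so solutions contract towards each other; this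
replaces the Lipschitz or compactness assumptions of the usual existence theorems. A monotone map
defined everywhere is locally bounded, and hemicontinuity then gives strong-to-weak continuity
(`IsMonotone.continuous_inner`). Dissipativity makes Euler polygons uniformly Cauchy, and their
limit solves the equation weakly (`exists_local_solution`). Every estimate rests on
`norm_le_of_barrier`, available because the squared norm of a continuous, weakly differentiable
curve is differentiable.

Comparing a solution with its time translates gives a Lipschitz constant independent of the
interval, which excludes breakdown in finite time. It also shows that the speed plus a multiple of
`ε` decreases, so the speed has only countably many jumps; elsewhere the weak derivative is a norm
derivative.

Formally, the speed `p` satisfies `p' ≤ -ε p + M |ε'|`. Since `ε' = o(ε²)`, it follows that `p =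
o(ε)` (`eventually_norm_Phi_le`), that is, `F(u) + ε u = o(ε)`. Hence `F(u) → 0` and, for every zero
`z`, monotonicity gives `limsup ⟪u, u - z⟫ ≤ 0`. Weak limits of `u` are zeros by Minty's lemma;
taking `z` to be the weak limit makes the convergence strong, and `z = y` identifies the limit
(`tendsto_minimalNormZero`). -/

namespace DSM

/-! ### Weak derivatives and the barrier principle. -/

section Weak

variable {H : Type*} [NormedAddCommGroup H] [InnerProductSpace ℝ H]

/-- A weakly bounded sequence in a Hilbert space is bounded. -/
theorem exists_norm_le_of_weakly_bounded [CompleteSpace H] {q : ℕ → H}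
    (h : ∀ z, ∃ C, ∀ n, |⟪q n, z⟫| ≤ C) : ∃ C, ∀ n, ‖q n‖ ≤ C := by
  obtain ⟨C, hC⟩ := banach_steinhaus (g := fun n => innerSL ℝ (q n)) (by simpa using h)
  exact ⟨C, fun n => by simpa using hC n⟩

/-- The squared norm of a continuous, weakly differentiable function is differentiable. -/
theorem hasDerivWithinAt_norm_sq_of_weak [CompleteSpace H] {w : ℝ → H} {d : H} {S : Set ℝ} {t : ℝ}
    (hc : ContinuousWithinAt w S t)
    (hd : ∀ z, HasDerivWithinAt (fun s => ⟪w s, z⟫) ⟪d, z⟫ S t) :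
    HasDerivWithinAt (fun s => ‖w s‖ ^ 2) (2 * ⟪d, w t⟫) S t := by
  rw [hasDerivWithinAt_iff_tendsto_slope]
  -- Along a sequence, convergent pairings are bounded on the whole index set, as Banach–Steinhaus
  -- requires.
  refine tendsto_of_seq_tendsto fun x hx => ?_
  set q : ℕ → H := fun n => (x n - t)⁻¹ • (w (x n) - w t) with hq
  have hqz : ∀ z, Tendsto (fun n => ⟪q n, z⟫) atTop (𝓝 ⟪d, z⟫) := by
    intro z
    have h := (hasDerivWithinAt_iff_tendsto_slope.1 (hd z)).comp hx
    refine h.congr fun n => ?_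
    simp [q, slope_def_field, inner_smul_left, inner_sub_left, div_eq_inv_mul]
  obtain ⟨C, hC⟩ := exists_norm_le_of_weakly_bounded (q := q) fun z => by
    obtain ⟨C, hC⟩ := ((hqz z).abs.bddAbove_range)
    exact ⟨C, fun n => hC ⟨n, rfl⟩⟩
  have hw : Tendsto (fun n => w (x n)) atTop (𝓝 (w t)) :=
    hc.tendsto.comp (hx.mono_right (nhdsWithin_mono _ sdiff_subset))
  have h0 : Tendsto (fun n => ⟪q n, w (x n) - w t⟫) atTop (𝓝 0) := by
    refine squeeze_zero_norm (a := fun n => C * ‖w (x n) - w t‖) (fun n => ?_) ?_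
    · exact (norm_inner_le_norm _ _).trans (mul_le_mul_of_nonneg_right (hC n) (norm_nonneg _))
    · simpa using (tendsto_iff_norm_sub_tendsto_zero.1 hw).const_mul C
  -- The difference quotient of `‖w‖ ^ 2` is `2⟪q, w t⟫ + ⟪q, w (x n) - w t⟫`.
  have h := ((hqz (w t)).const_mul 2).add h0
  rw [add_zero] at h
  refine h.congr fun n => ?_
  simp only [Function.comp, slope_def_field, q, inner_smul_left, inner_sub_left, inner_sub_right,
    real_inner_self_eq_norm_sq, real_inner_comm (w (x n)) (w t), RCLike.conj_to_real]
  ring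

/-- Fencing: if `β ≥ 0` starts above `‖w‖` and grows faster wherever they touch, it stays above. -/
theorem norm_le_of_barrier [CompleteSpace H] {w w' : ℝ → H} {β β' : ℝ → ℝ} {a b : ℝ}
    (hw : ContinuousOn w (Icc a b))
    (hw' : ∀ t ∈ Ico a b, ∀ z, HasDerivWithinAt (fun s => ⟪w s, z⟫) ⟪w' t, z⟫ (Ici t) t)
    (hβ : ContinuousOn β (Icc a b))
    (hβ' : ∀ t ∈ Ico a b, HasDerivWithinAt β (β' t) (Ici t) t)
    (hpos : ∀ t ∈ Icc a b, 0 ≤ β t) (ha : ‖w a‖ ≤ β a)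
    (hlt : ∀ t ∈ Ico a b, ‖w t‖ = β t → ⟪w' t, w t⟫ < β' t * β t) :
    ∀ t ∈ Icc a b, ‖w t‖ ≤ β t := by
  intro t ht
  have key : ‖w t‖ ^ 2 ≤ β t ^ 2 := by
    refine image_le_of_deriv_right_lt_deriv_boundary' (f := fun s => ‖w s‖ ^ 2)
      (f' := fun s => 2 * ⟪w' s, w s⟫) (B := fun s => β s ^ 2) (B' := fun s => 2 * (β' s * β s))
      (hw.norm.pow 2) ?_ (by gcongr) (hβ.pow 2) ?_ ?_ ht
    · intro s hs
      refine hasDerivWithinAt_norm_sq_of_weak ?_ (hw' s hs)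
      have h := hw s (Ico_subset_Icc_self hs)
      refine h.mono_of_mem_nhdsWithin (mem_of_superset (Icc_mem_nhdsGE hs.2)
        (Icc_subset_Icc_left hs.1))
    · intro s hs
      have := (hβ' s hs).pow 2
      refine this.congr_deriv ?_
      simp; ring
    · intro s hs h
      have h' : ‖w s‖ = β s :=
        (pow_left_inj₀ (norm_nonneg _) (hpos s (Ico_subset_Icc_self hs)) two_ne_zero).1 h
      have := hlt s hs h'
      linarith
  exact (pow_le_pow_iff_left₀ (norm_nonneg _) (hpos t ht) two_ne_zero).1 key

/-- A weak derivative is a derivative in norm if the difference quotients are asymptotically no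
longer than it. -/
theorem hasDerivWithinAt_of_weak {u : ℝ → H} {d : H} {S : Set ℝ} {t : ℝ}
    (hd : HasDerivWithinAt (fun s => ⟪u s, d⟫) ⟪d, d⟫ S t)
    (hn : ∀ η > 0, ∀ᶠ s in 𝓝[S] t, ‖u s - u t‖ ≤ (‖d‖ + η) * |s - t|) :
    HasDerivWithinAt u d S t := by
  rw [hasDerivWithinAt_iff_isLittleO, Asymptotics.isLittleO_iff] at hd ⊢
  intro c hc
  -- Expanding `‖u s - u t - (s - t) • d‖ ^ 2` and inserting both hypotheses leaves exactly this
  -- factor times `(s - t) ^ 2`.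
  obtain ⟨η, hη, hηc⟩ : ∃ η > 0, (‖d‖ + η) ^ 2 - ‖d‖ ^ 2 + 2 * η ≤ c ^ 2 := by
    refine ⟨min 1 (c ^ 2 / (2 * ‖d‖ + 3)), by positivity, ?_⟩
    set η := min 1 (c ^ 2 / (2 * ‖d‖ + 3))
    have h1 : η ≤ 1 := min_le_left _ _
    have h0 : 0 < η := by positivity
    have h2 : η * (2 * ‖d‖ + 3) ≤ c ^ 2 := by
      rw [← le_div_iff₀ (by positivity)]; exact min_le_right _ _
    nlinarith
  filter_upwards [hd hη, hn η hη] with s h1 h2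
  simp only [Real.norm_eq_abs, smul_eq_mul] at h1 ⊢
  rw [← inner_sub_left, real_inner_self_eq_norm_sq] at h1
  refine (pow_le_pow_iff_left₀ (norm_nonneg _) (by positivity) two_ne_zero).1 ?_
  rw [norm_sub_sq_real, inner_smul_right, norm_smul, mul_pow, mul_pow, Real.norm_eq_abs, sq_abs]
  have h3 : ‖u s - u t‖ ^ 2 ≤ (‖d‖ + η) ^ 2 * (s - t) ^ 2 := by
    rw [← sq_abs (s - t), ← mul_pow]; gcongr
  have h4 : (s - t) * ⟪u s - u t, d⟫ ≥ (s - t) ^ 2 * ‖d‖ ^ 2 - η * (s - t) ^ 2 := by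
    have h5 : |s - t| * |⟪u s - u t, d⟫ - (s - t) * ‖d‖ ^ 2| ≤ |s - t| * (η * |s - t|) := by gcongr
    rw [← abs_mul, mul_left_comm, abs_mul_abs_self] at h5
    have := (abs_le.1 h5).1
    nlinarith
  nlinarith [mul_le_mul_of_nonneg_right hηc (sq_nonneg (s - t))]

end Weak

/-! ### Local boundedness and demicontinuity of monotone maps. -/

section Monotone

variable {H : Type*} [NormedAddCommGroup H] [InnerProductSpace ℝ H]

/-- A monotone operator defined everywhere is bounded along convergent sequences. -/
theorem IsMonotone.exists_eventually_norm_le_of_tendsto [CompleteSpace H] {F : H → H} (hF : IsMonotone F)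
    {x : H} {p : ℕ → H} (hp : Tendsto p atTop (𝓝 x)) :
    ∃ C, ∀ᶠ n in atTop, ‖F (p n)‖ ≤ C := by
  -- Monotonicity tested at `x + v` bounds `⟪F (p n), v⟫` by `‖F (p n)‖ * ‖p n - x‖` plus a
  -- constant, so `F (p n) / a n` is weakly bounded.
  set a : ℕ → ℝ := fun n => 1 + ‖F (p n)‖ * ‖p n - x‖ with ha
  have ha1 : ∀ n, 1 ≤ a n := fun n => by
    linarith [mul_nonneg (norm_nonneg (F (p n))) (norm_nonneg (p n - x))]
  obtain ⟨M, hM⟩ := (tendsto_iff_norm_sub_tendsto_zero.1 hp).bddAbove_range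
  have hM' : ∀ n, ‖p n - x‖ ≤ M := fun n => hM ⟨n, rfl⟩
  have one_side : ∀ v n, ⟪F (p n), v⟫ ≤ a n * (1 + ‖F (x + v)‖ * (M + ‖v‖)) := by
    intro v n
    have h := hF (p n) (x + v)
    have e : ⟪F (p n) - F (x + v), p n - (x + v)⟫
        = ⟪F (p n), p n - x⟫ - ⟪F (p n), v⟫ - ⟪F (x + v), (p n - x) - v⟫ := by
      rw [← sub_sub, inner_sub_left, inner_sub_right (F (p n))]
    rw [e] at h
    have h1 := real_inner_le_norm (F (p n)) (p n - x)
    have h2 := (abs_le.1 (abs_real_inner_le_norm (F (x + v)) ((p n - x) - v))).1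
    have h3 : ‖(p n - x) - v‖ ≤ M + ‖v‖ := (norm_sub_le _ _).trans (by gcongr; exact hM' n)
    have h4 : ‖F (x + v)‖ * ‖(p n - x) - v‖ ≤ ‖F (x + v)‖ * (M + ‖v‖) := by gcongr
    have h5 : 0 ≤ ‖F (x + v)‖ * (M + ‖v‖) := le_trans (by positivity) h4
    have h6 := ha1 n
    have h7 : ‖F (p n)‖ * ‖p n - x‖ ≤ a n := by simp [a]
    nlinarith
  obtain ⟨C, hC⟩ := exists_norm_le_of_weakly_bounded (q := fun n => (a n)⁻¹ • F (p n)) fun z => by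
    refine ⟨max (1 + ‖F (x + z)‖ * (M + ‖z‖)) (1 + ‖F (x + -z)‖ * (M + ‖-z‖)), fun n => ?_⟩
    have hpos : 0 < a n := by linarith [ha1 n]
    rw [inner_smul_left, RCLike.conj_to_real, abs_le']
    constructor
    · refine le_trans ?_ (le_max_left _ _)
      rw [inv_mul_le_iff₀ hpos]; exact one_side z n
    · refine le_trans ?_ (le_max_right _ _)
      rw [← mul_neg, ← inner_neg_right, inv_mul_le_iff₀ hpos]; exact one_side (-z) n
  have hC0 : 0 ≤ C := (norm_nonneg _).trans (hC 0)
  refine ⟨2 * C, ?_⟩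
  -- So close to `x`, the term `C * ‖F (p n)‖ * ‖p n - x‖` is absorbed into the left-hand side.
  have hsmall : ∀ᶠ n in atTop, ‖p n - x‖ < 1 / (2 * (C + 1)) :=
    (tendsto_iff_norm_sub_tendsto_zero.1 hp).eventually_lt_const (by positivity)
  filter_upwards [hsmall] with n hn
  have h := hC n
  have hpos : 0 < a n := by linarith [ha1 n]
  rw [norm_smul, norm_inv, Real.norm_of_nonneg hpos.le, inv_mul_le_iff₀ hpos] at h
  rw [lt_div_iff₀ (by positivity)] at hn
  simp only [a] at h
  have h8 : ‖F (p n)‖ * (‖p n - x‖ * (2 * (C + 1))) ≤ ‖F (p n)‖ * 1 := by gcongr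
  nlinarith [mul_nonneg (norm_nonneg (F (p n))) (norm_nonneg (p n - x))]

/-- A monotone operator defined everywhere is locally bounded. -/
theorem IsMonotone.locally_bounded [CompleteSpace H] {F : H → H} (hF : IsMonotone F) (x : H) :
    ∃ r > 0, ∃ K, ∀ v, ‖v - x‖ ≤ r → ‖F v‖ ≤ K := by
  by_contra! h
  choose p hp hpF using fun n : ℕ => h (1 / ((n : ℝ) + 1)) (by positivity) n
  have hlim : Tendsto p atTop (𝓝 x) :=
    tendsto_iff_norm_sub_tendsto_zero.2
      (squeeze_zero (fun _ => norm_nonneg _) hp tendsto_one_div_add_atTop_nhds_zero_nat)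
  obtain ⟨C, hC⟩ := hF.exists_eventually_norm_le_of_tendsto hlim
  obtain ⟨n, h1, h2⟩ := (hC.and (eventually_ge_atTop ⌈C⌉₊)).exists
  have h3 : C ≤ n := (Nat.le_ceil C).trans (by exact_mod_cast h2)
  linarith [hpF n]

/-- Monotonicity between `v` and `x + τ • z` bounds `τ * ⟪F v, z⟫` by `τ * ⟪F (x + τ • z), z⟫` plus
terms of size `‖v - x‖`, thanks to local boundedness. Hemicontinuity fixes `τ` first; then `v → x`.
Using `z` and `-z` yields demicontinuity. -/
theorem IsMonotone.eventually_inner_lt [CompleteSpace H] {F : H → H} (hF : IsMonotone F)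
    (hh : IsHemicontinuous F) (x z : H) {η : ℝ} (hη : 0 < η) :
    ∀ᶠ v in 𝓝 x, ⟪F v, z⟫ < ⟪F x, z⟫ + η := by
  obtain ⟨r, hr, K, hK⟩ := hF.locally_bounded x
  have h1 : ∀ᶠ τ in 𝓝[>] (0 : ℝ), ⟪F (x + τ • z), z⟫ < ⟪F x, z⟫ + η / 2 :=
    ((hh x z z).mono_left nhdsWithin_le_nhds).eventually_lt_const (by linarith)
  obtain ⟨τ, hτ, hτ0⟩ := (h1.and self_mem_nhdsWithin).exists
  have hτ0 : 0 < τ := hτ0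
  have hlim : Tendsto (fun v => (K + ‖F (x + τ • z)‖) * ‖v - x‖) (𝓝 x) (𝓝 0) := by
    have : Continuous fun v => (K + ‖F (x + τ • z)‖) * ‖v - x‖ := by fun_prop
    simpa using this.tendsto x
  filter_upwards [Metric.closedBall_mem_nhds x hr,
    hlim.eventually_lt_const (show 0 < τ * (η / 2) by positivity)] with v hv hsm
  have hKv := hK v (by simpa [dist_eq_norm] using hv)
  have h := hF v (x + τ • z)
  have e : ⟪F v - F (x + τ • z), v - (x + τ • z)⟫ = ⟪F v, v - x⟫ - τ * ⟪F v, z⟫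
      - ⟪F (x + τ • z), v - x⟫ + τ * ⟪F (x + τ • z), z⟫ := by
    rw [← sub_sub, inner_sub_left, inner_sub_right (F v), inner_sub_right (F (x + τ • z)),
      inner_smul_right, inner_smul_right]
    ring
  rw [e] at h
  have h2 := (real_inner_le_norm (F v) (v - x)).trans
    (mul_le_mul_of_nonneg_right hKv (norm_nonneg _))
  have h3 := (abs_le.1 (abs_real_inner_le_norm (F (x + τ • z)) (v - x))).1
  have h4 : τ * ⟪F v, z⟫ < τ * (⟪F x, z⟫ + η) := by nlinarith
  exact lt_of_mul_lt_mul_left h4 hτ0.le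

/-- A monotone hemicontinuous operator defined everywhere is demicontinuous. -/
theorem IsMonotone.continuous_inner [CompleteSpace H] {F : H → H} (hF : IsMonotone F)
    (hh : IsHemicontinuous F) (z : H) : Continuous fun x => ⟪F x, z⟫ := by
  refine continuous_iff_continuousAt.2 fun x => Metric.tendsto_nhds.2 fun η hη => ?_
  filter_upwards [hF.eventually_inner_lt hh x z hη, hF.eventually_inner_lt hh x (-z) hη]
    with v h1 h2
  rw [inner_neg_right, inner_neg_right] at h2
  rw [Real.dist_eq, abs_lt]
  constructor <;> linarith

end Monotone

/-! ### Concatenation of curves, and Euler polygons. -/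

section Glue

variable {H : Type*}

/-- The function equal to `u` up to time `c` and to `v` afterwards. -/
noncomputable def glue (c : ℝ) (u v : ℝ → H) (t : ℝ) : H := by
  classical exact if t ≤ c then u t else v t

theorem glue_of_le {c t : ℝ} (u v : ℝ → H) (h : t ≤ c) : glue c u v t = u t := by
  simp [glue, h]

theorem glue_of_ge {c t : ℝ} {u v : ℝ → H} (huv : u c = v c) (h : c ≤ t) : glue c u v t = v t := by
  rcases h.eq_or_lt with rfl | h
  · simp [glue, huv]
  · simp [glue, h.not_ge]

theorem glue_eventuallyEq {c t : ℝ} (u v : ℝ → H) (h : t < c) : glue c u v =ᶠ[𝓝[≥] t] u :=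
  mem_of_superset (Icc_mem_nhdsGE h) fun _ hs => glue_of_le u v hs.2

theorem continuousOn_glue [TopologicalSpace H] {a c d : ℝ} {u v : ℝ → H} (huv : u c = v c)
    (hu : ContinuousOn u (Icc a c)) (hv : ContinuousOn v (Icc c d)) :
    ContinuousOn (glue c u v) (Icc a d) := by
  refine ContinuousOn.mono (ContinuousOn.union_of_isClosed
    (hu.congr fun t ht => glue_of_le u v ht.2) (hv.congr fun t ht => glue_of_ge huv ht.1)
    isClosed_Icc isClosed_Icc) fun t ht => ?_
  rcases le_total t c with h | h
  · exact Or.inl ⟨ht.1, h⟩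
  · exact Or.inr ⟨h, ht.2⟩

end Glue

variable {H : Type*} [NormedAddCommGroup H] [InnerProductSpace ℝ H]

/-- `w` solves `w' = Φ(t, w)`, `w(a) = x` on `[a, b]` up to an error `δ`, staying close to the ball
of radius `r` about `x`. -/
structure IsApproxSolution (Φ : ℝ → H → H) (x : H) (r δ a b : ℝ) (w : ℝ → H) : Prop where
  continuousOn : ContinuousOn w (Icc a b)
  initial : w a = x
  rightDeriv : ∀ t ∈ Ico a b, ∃ ξ, ‖ξ - x‖ ≤ r ∧ ‖w t - ξ‖ ≤ δ ∧
    HasDerivWithinAt w (Φ t ξ) (Ici t) t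

section Approx

variable {Φ : ℝ → H → H} {x : H} {r δ K a b : ℝ}

theorem IsApproxSolution.norm_image_sub_le {w : ℝ → H} (hw : IsApproxSolution Φ x r δ a b w)
    (hK : ∀ t ∈ Icc a b, ∀ ξ, ‖ξ - x‖ ≤ r → ‖Φ t ξ‖ ≤ K) {s t : ℝ} (has : a ≤ s) (hst : s ≤ t)
    (htb : t ≤ b) :
    ‖w t - w s‖ ≤ K * (t - s) := by
  choose! ξ hξ using hw.rightDeriv
  have hsub : Ico s t ⊆ Ico a b := Ico_subset_Ico has htb
  exact norm_image_sub_le_of_norm_deriv_right_le_segment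
    (hw.continuousOn.mono (Icc_subset_Icc has htb)) (fun τ hτ => (hξ τ (hsub hτ)).2.2)
    (fun τ hτ => hK τ (Ico_subset_Icc_self (hsub hτ)) _ (hξ τ (hsub hτ)).1) t (right_mem_Icc.2 hst)

variable [CompleteSpace H]

/-- One Euler step: the state is frozen at `w c` while time keeps running, as `Φ` is norm continuous
in time only. The bound `K * (b - a) ≤ r` keeps the node in the ball, and `K * (c' - c) ≤ δ` bounds
the drift from it. -/
theorem IsApproxSolution.exists_extend {c c' : ℝ} {w : ℝ → H}
    (hw : IsApproxSolution Φ x r δ a c w)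
    (hc : ∀ ξ, Continuous fun t => Φ t ξ)
    (hK : ∀ t ∈ Icc a b, ∀ ξ, ‖ξ - x‖ ≤ r → ‖Φ t ξ‖ ≤ K) (hK0 : 0 ≤ K)
    (hr : K * (b - a) ≤ r) (hac : a ≤ c) (hcc : c ≤ c') (hcb : c' ≤ b) (hδ : K * (c' - c) ≤ δ) :
    ∃ w', IsApproxSolution Φ x r δ a c' w' := by
  have hball : ‖w c - x‖ ≤ r := by
    have h := hw.norm_image_sub_le
      (fun t ht => hK t ⟨ht.1, ht.2.trans (hcc.trans hcb)⟩) le_rfl hac le_rfl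
    rw [hw.initial] at h
    exact h.trans (le_trans (by gcongr; linarith) hr)
  set v : ℝ → H := fun t => w c + ∫ s in c..t, Φ s (w c) with hv
  have hvc : w c = v c := by simp [v]
  have hvd : ∀ t, HasDerivAt v (Φ t (w c)) t := fun t =>
    ((hc (w c)).integral_hasStrictDerivAt c t).hasDerivAt.const_add _
  have hvcont : Continuous v := continuous_iff_continuousAt.2 fun t => (hvd t).continuousAt
  refine ⟨glue c w v, continuousOn_glue hvc hw.continuousOn hvcont.continuousOn,
    by rw [glue_of_le w v hac, hw.initial], fun t ht => ?_⟩
  rcases lt_or_ge t c with h | h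
  · obtain ⟨ξ, h1, h2, h3⟩ := hw.rightDeriv t ⟨ht.1, h⟩
    refine ⟨ξ, h1, by rwa [glue_of_le w v h.le], ?_⟩
    exact h3.congr_of_eventuallyEq (glue_eventuallyEq w v h) (glue_of_le w v h.le)
  · refine ⟨w c, hball, ?_, ?_⟩
    · rw [glue_of_ge hvc h, hvc]
      refine (norm_image_sub_le_of_norm_deriv_right_le_segment (C := K) (b := t)
        hvcont.continuousOn (fun s _ => (hvd s).hasDerivWithinAt) (fun s hs => ?_) t
        (right_mem_Icc.2 h)).trans (le_trans (by gcongr; exact ht.2.le) hδ)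
      exact hK s ⟨hac.trans hs.1, hs.2.le.trans (ht.2.le.trans hcb)⟩ _ hball
    · exact (hvd t).hasDerivWithinAt.congr (fun s hs => glue_of_ge hvc (h.trans hs))
        (glue_of_ge hvc h)

/-- Euler polygons. -/
theorem exists_isApproxSolution (hc : ∀ ξ, Continuous fun t => Φ t ξ)
    (hK : ∀ t ∈ Icc a b, ∀ ξ, ‖ξ - x‖ ≤ r → ‖Φ t ξ‖ ≤ K) (hK0 : 0 ≤ K) (hab : a ≤ b)
    (hr : K * (b - a) ≤ r) (hδ : 0 < δ) : ∃ w, IsApproxSolution Φ x r δ a b w := by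
  obtain ⟨N, hN⟩ := exists_nat_gt (K * (b - a) / δ)
  have hba : 0 ≤ b - a := sub_nonneg.2 hab
  have hN0 : (0 : ℝ) < N := lt_of_le_of_lt (by positivity) hN
  set h : ℝ := (b - a) / N with hh
  have h0 : 0 ≤ h := by positivity
  have hKh : K * h ≤ δ := by
    rw [div_lt_iff₀ hδ] at hN
    rw [hh, mul_div_assoc', div_le_iff₀ hN0]; linarith
  have hNh : a + N * h = b := by rw [hh]; field_simp; ring
  have step : ∀ k : ℕ, k ≤ N → ∃ w, IsApproxSolution Φ x r δ a (a + k * h) w := by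
    intro k
    induction k with
    | zero =>
      intro _
      exact ⟨fun _ => x, continuousOn_const, rfl, fun t ht => by
        simp at ht⟩
    | succ k ih =>
      intro hk
      obtain ⟨w, hw⟩ := ih (by omega)
      have hk' : ((k + 1 : ℕ) : ℝ) ≤ N := by exact_mod_cast hk
      refine hw.exists_extend hc hK hK0 hr (by linarith [mul_nonneg (Nat.cast_nonneg (α := ℝ) k) h0]) ?_ ?_ ?_
      · push_cast; linarith
      · rw [← hNh]; gcongr
      · push_cast
        have : a + ((k : ℝ) + 1) * h - (a + k * h) = h := by ring
        rwa [this]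
  simpa [hNh] using step N le_rfl

/-- Two approximate solutions of a dissipative equation are close. -/
theorem IsApproxSolution.norm_sub_le_of_dissipative {δ₁ δ₂ κ : ℝ} {w₁ w₂ : ℝ → H}
    (h₁ : IsApproxSolution Φ x r δ₁ a b w₁) (h₂ : IsApproxSolution Φ x r δ₂ a b w₂)
    (hdis : ∀ t ∈ Icc a b, ∀ u v, ⟪Φ t u - Φ t v, u - v⟫ ≤ 0)
    (hK : ∀ t ∈ Icc a b, ∀ ξ, ‖ξ - x‖ ≤ r → ‖Φ t ξ‖ ≤ K)
    (hκ : 0 < κ) (hδ : 2 * K * (δ₁ + δ₂) < κ ^ 2) :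
    ∀ t ∈ Icc a b, ‖w₁ t - w₂ t‖ ≤ κ * (1 + (t - a)) := by
  choose! ξ₁ hξ₁ using h₁.rightDeriv
  choose! ξ₂ hξ₂ using h₂.rightDeriv
  -- Dissipativity holds at the nodes; moving from nodes to polygons costs at most `2 * K * (δ₁ +
  -- δ₂)`, which is less than `κ ^ 2`, a lower bound for `β' * β`.
  refine norm_le_of_barrier (w' := fun t => Φ t (ξ₁ t) - Φ t (ξ₂ t)) (β' := fun _ => κ)
    (h₁.continuousOn.sub h₂.continuousOn) (fun t ht z => ?_) (by fun_prop) (fun t _ => ?_)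
    (fun t ht => ?_) (by simp [h₁.initial, h₂.initial, hκ.le]) (fun t ht _ => ?_)
  · have := ((hξ₁ t ht).2.2.sub (hξ₂ t ht).2.2).inner ℝ (hasDerivWithinAt_const t (Ici t) z)
    simpa using this
  · simpa using ((((hasDerivAt_id t).sub_const a).const_add 1).const_mul κ).hasDerivWithinAt
  · have := sub_nonneg.2 ht.1; positivity
  · have ht' := Ico_subset_Icc_self ht
    have hn := norm_sub_le (w₁ t - ξ₁ t) (w₂ t - ξ₂ t)
    have hΦ : ‖Φ t (ξ₁ t) - Φ t (ξ₂ t)‖ ≤ 2 * K := by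
      have := norm_sub_le (Φ t (ξ₁ t)) (Φ t (ξ₂ t))
      linarith [hK t ht' _ (hξ₁ t ht).1, hK t ht' _ (hξ₂ t ht).1]
    have e : w₁ t - w₂ t = (ξ₁ t - ξ₂ t) + ((w₁ t - ξ₁ t) - (w₂ t - ξ₂ t)) := by abel
    have h3 : ⟪Φ t (ξ₁ t) - Φ t (ξ₂ t), (w₁ t - ξ₁ t) - (w₂ t - ξ₂ t)⟫ ≤ 2 * K * (δ₁ + δ₂) := by
      refine (real_inner_le_norm _ _).trans (mul_le_mul hΦ ?_ (norm_nonneg _)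
        ((norm_nonneg _).trans hΦ))
      linarith [(hξ₁ t ht).2.1, (hξ₂ t ht).2.1]
    have h4 := hdis t ht' (ξ₁ t) (ξ₂ t)
    show ⟪Φ t (ξ₁ t) - Φ t (ξ₂ t), w₁ t - w₂ t⟫ < _
    rw [e, inner_add_right]
    nlinarith [mul_nonneg (sq_nonneg κ) (sub_nonneg.2 ht.1)]

end Approx

/-! ### Right solutions and local existence. -/

/-- `u` is continuous on `[a, b]` and solves `u' = Φ(t, u)` on `[a, b)`, the derivative being taken
from the right and in the weak topology. -/
structure IsRightSolution (Φ : ℝ → H → H) (a b : ℝ) (u : ℝ → H) : Prop where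
  continuousOn : ContinuousOn u (Icc a b)
  rightDeriv : ∀ t ∈ Ico a b, ∀ z : H,
    HasDerivWithinAt (fun s => ⟪u s, z⟫) ⟪Φ t (u t), z⟫ (Ici t) t

section Local

variable {Φ : ℝ → H → H} {x : H} {r K a b : ℝ}

/-- Near `t` and for large `n`, all nodes lie within `ρ` of `u t`: one third each for the node
error, the uniform convergence and the continuity of `u`. The mean value inequality then bounds the
increments of `⟪w n, z⟫` uniformly in `n`, and this survives the limit. -/
theorem isRightSolution_of_tendsto
    (hdemi : ∀ z, Continuous fun p : ℝ × H => ⟪Φ p.1 p.2, z⟫)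
    {δ : ℕ → ℝ} (hδ : Tendsto δ atTop (𝓝 0)) {w : ℕ → ℝ → H} {u : ℝ → H}
    (hw : ∀ n, IsApproxSolution Φ x r (δ n) a b (w n))
    (hu : TendstoUniformlyOn w u atTop (Icc a b)) : IsRightSolution Φ a b u := by
  have hcu : ContinuousOn u (Icc a b) :=
    hu.continuousOn (Frequently.of_forall fun n => (hw n).continuousOn)
  refine ⟨hcu, fun t ht z => ?_⟩
  rw [hasDerivWithinAt_iff_isLittleO, Asymptotics.isLittleO_iff]
  intro η hη
  obtain ⟨ρ, hρ, hρΦ⟩ := Metric.continuous_iff.1 (hdemi z) (t, u t) η hη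
  have hcr : ContinuousWithinAt u (Ici t) t :=
    (hcu t (Ico_subset_Icc_self ht)).mono_of_mem_nhdsWithin
      (mem_of_superset (Icc_mem_nhdsGE ht.2) (Icc_subset_Icc_left ht.1))
  obtain ⟨e, het, heu⟩ : ∃ e, t < e ∧ ∀ s ∈ Ico t e, s < b ∧ dist s t < ρ ∧ dist (u s) (u t) < ρ / 3 := by
    have h : ∀ᶠ s in 𝓝[≥] t, s < b ∧ dist s t < ρ ∧ dist (u s) (u t) < ρ / 3 := by
      refine ((eventually_lt_nhds ht.2).filter_mono nhdsWithin_le_nhds).and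
        (((Metric.eventually_nhds_iff_ball.2 ⟨ρ, hρ, fun s hs => hs⟩).filter_mono
          nhdsWithin_le_nhds).and ?_)
      exact Metric.tendsto_nhds.1 hcr _ (by positivity)
    obtain ⟨e, he, hes⟩ := mem_nhdsGE_iff_exists_Ico_subset.1 h
    exact ⟨e, he, fun s hs => hes hs⟩
  have hlarge : ∀ᶠ n in atTop, ∀ s ∈ Ico t e,
      ‖⟪w n s, z⟫ - ⟪w n t, z⟫ - (s - t) * ⟪Φ t (u t), z⟫‖ ≤ η * (s - t) := by
    filter_upwards [Metric.tendstoUniformlyOn_iff.1 hu (ρ / 3) (by positivity),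
      hδ.eventually_lt_const (show 0 < ρ / 3 by positivity)] with n hn1 hn2 s hs
    have hsub : Icc t s ⊆ Icc a b := Icc_subset_Icc ht.1 (heu s hs).1.le
    choose! ξ hξ using (hw n).rightDeriv
    have hsub' : ∀ τ ∈ Ico t s, τ ∈ Ico a b := fun τ hτ =>
      ⟨ht.1.trans hτ.1, hτ.2.trans (heu s hs).1⟩
    have hmv := norm_image_sub_le_of_norm_deriv_right_le_segment (a := t) (b := s) (C := η)
      (f := fun τ => ⟪w n τ, z⟫ - τ * ⟪Φ t (u t), z⟫)
      (f' := fun τ => ⟪Φ τ (ξ τ), z⟫ - ⟪Φ t (u t), z⟫)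
      ((((hw n).continuousOn.mono hsub).inner continuousOn_const).sub (by fun_prop))
      (fun τ hτ => ?_) (fun τ hτ => ?_) s (right_mem_Icc.2 hs.1)
    · refine le_trans (le_of_eq ?_) hmv
      congr 1; ring
    · have h1 := (hξ τ (hsub' τ hτ)).2.2.inner ℝ (hasDerivWithinAt_const τ (Ici τ) z)
      have h2 := ((hasDerivAt_id τ).mul_const ⟪Φ t (u t), z⟫).hasDerivWithinAt (s := Ici τ)
      simpa using h1.fun_sub h2
    · have h1 := hρΦ (τ, ξ τ) ?_
      · exact (Real.dist_eq _ _ ▸ h1).le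
      · obtain ⟨h2, h3, h4⟩ := heu τ ⟨hτ.1, hτ.2.trans hs.2⟩
        rw [Prod.dist_eq, max_lt_iff]
        refine ⟨h3, ?_⟩
        have h5 := hn1 τ (hsub ⟨hτ.1, hτ.2.le⟩)
        have h6 := (hξ τ (hsub' τ hτ)).2.1
        rw [← dist_eq_norm] at h6
        calc dist (ξ τ) (u t) ≤ dist (ξ τ) (w n τ) + dist (w n τ) (u τ) + dist (u τ) (u t) :=
              dist_triangle4 _ _ _ _
          _ < ρ := by rw [dist_comm (ξ τ), dist_comm (w n τ) (u τ)]; linarith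
  filter_upwards [Ico_mem_nhdsGE het] with s hs
  rw [Real.norm_eq_abs (s - t), abs_of_nonneg (sub_nonneg.2 hs.1), smul_eq_mul]
  have hlim : ∀ τ ∈ Icc a b, Tendsto (fun n => ⟪w n τ, z⟫) atTop (𝓝 ⟪u τ, z⟫) := fun τ hτ =>
    (hu.tendsto_at hτ).inner tendsto_const_nhds
  refine le_of_tendsto (((hlim s ⟨ht.1.trans hs.1, (heu s hs).1.le⟩).sub
    (hlim t (Ico_subset_Icc_self ht))).sub_const _).norm (hlarge.mono fun n hn => hn s hs)

/-- Local existence for a dissipative, demicontinuous right-hand side. -/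
theorem exists_local_solution [CompleteSpace H]
    (hdemi : ∀ z, Continuous fun p : ℝ × H => ⟪Φ p.1 p.2, z⟫)
    (hc : ∀ ξ, Continuous fun t => Φ t ξ)
    (hdis : ∀ t ∈ Icc a b, ∀ u v, ⟪Φ t u - Φ t v, u - v⟫ ≤ 0)
    (hK : ∀ t ∈ Icc a b, ∀ ξ, ‖ξ - x‖ ≤ r → ‖Φ t ξ‖ ≤ K) (hK0 : 0 ≤ K) (hab : a ≤ b)
    (hr : K * (b - a) ≤ r) : ∃ u, u a = x ∧ IsRightSolution Φ a b u := by
  set δ : ℕ → ℝ := fun n => 1 / ((n : ℝ) + 1) with hδdef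
  have hδ : Tendsto δ atTop (𝓝 0) := tendsto_one_div_add_atTop_nhds_zero_nat
  choose w hw using fun n => exists_isApproxSolution hc hK hK0 hab hr (δ := δ n)
    (by simp only [δ]; positivity)
  have hba : 0 ≤ b - a := sub_nonneg.2 hab
  have hcau : UniformCauchySeqOn w atTop (Icc a b) := by
    rw [Metric.uniformCauchySeqOn_iff]
    intro η hη
    set κ := η / (2 * (1 + (b - a))) with hκdef
    have hκ : 0 < κ := by positivity
    have hlim : Tendsto (fun n => 4 * K * δ n) atTop (𝓝 0) := by simpa using hδ.const_mul (4 * K)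
    obtain ⟨N, hN⟩ := eventually_atTop.1 (hlim.eventually_lt_const (show 0 < κ ^ 2 by positivity))
    refine ⟨N, fun m hm n hn t ht => ?_⟩
    have h := (hw m).norm_sub_le_of_dissipative (hw n) hdis hK hκ
      (by linarith [hN m hm, hN n hn]) t ht
    rw [dist_eq_norm]
    have h2 : κ * (1 + (t - a)) ≤ κ * (1 + (b - a)) := by gcongr; exact ht.2
    have h3 : κ * (1 + (b - a)) = η / 2 := by rw [hκdef]; field_simp
    linarith
  have hpt : ∀ t ∈ Icc a b, ∃ l, Tendsto (fun n => w n t) atTop (𝓝 l) := fun t ht =>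
    cauchySeq_tendsto_of_complete (hcau.cauchySeq ht)
  choose! u hu using hpt
  refine ⟨u, ?_, isRightSolution_of_tendsto hdemi hδ hw
    (hcau.tendstoUniformlyOn_of_tendsto hu)⟩
  refine tendsto_nhds_unique (hu a (left_mem_Icc.2 hab)) ?_
  simp [fun n => (hw n).initial]

end Local

/-! ### Comparison, uniqueness and growth estimates for right solutions. -/

section Comparison

variable {H : Type*} [NormedAddCommGroup H] [InnerProductSpace ℝ H] [CompleteSpace H]

/-- A differential form of the triangle inequality for integrals. -/
theorem norm_le_add_of_inner_le {w w' : ℝ → H} {B B' : ℝ → ℝ} {a b : ℝ}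
    (hw : ContinuousOn w (Icc a b))
    (hw' : ∀ t ∈ Ico a b, ∀ z, HasDerivWithinAt (fun s => ⟪w s, z⟫) ⟪w' t, z⟫ (Ici t) t)
    (hB : ContinuousOn B (Icc a b))
    (hB' : ∀ t ∈ Ico a b, HasDerivWithinAt B (B' t) (Ici t) t)
    (hmono : ∀ t ∈ Icc a b, B a ≤ B t)
    (hle : ∀ t ∈ Ico a b, ⟪w' t, w t⟫ ≤ B' t * ‖w t‖) :
    ∀ t ∈ Icc a b, ‖w t‖ ≤ ‖w a‖ + (B t - B a) := by
  intro t ht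
  refine le_of_forall_pos_le_add fun η hη => ?_
  have hat : 0 ≤ t - a := sub_nonneg.2 ht.1
  set κ := η / (1 + (t - a)) with hκdef
  have hκ : 0 < κ := by positivity
  have hpos : ∀ s ∈ Icc a b, κ ≤ ‖w a‖ + (B s - B a) + κ * (1 + (s - a)) := fun s hs => by
    have := mul_nonneg hκ.le (sub_nonneg.2 hs.1)
    linarith [hmono s hs, norm_nonneg (w a)]
  -- The added `κ * (1 + (s - a))` supplies the strict inequality at contact; `κ` is scaled so that
  -- it equals `η` at time `t`.
  have h := norm_le_of_barrier (β := fun s => ‖w a‖ + (B s - B a) + κ * (1 + (s - a)))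
    (β' := fun s => B' s + κ) hw hw' (by fun_prop) (fun s hs => ?_)
    (fun s hs => hκ.le.trans (hpos s hs)) (by simp [hκ.le]) (fun s hs hws => ?_) t ht
  · have e : κ * (1 + (t - a)) = η := by rw [hκdef]; field_simp
    linarith
  · have h1 := ((((hasDerivAt_id s).sub_const a).const_add 1).const_mul κ).hasDerivWithinAt
      (s := Ici s)
    simpa using (((hB' s hs).sub_const (B a)).const_add ‖w a‖).fun_add h1
  · have h1 := hle s hs
    have h2 := hpos s (Ico_subset_Icc_self hs)
    rw [hws] at h1
    nlinarith

end Comparison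

section Solutions

variable {H : Type*} [NormedAddCommGroup H] [InnerProductSpace ℝ H]
  {Φ Ψ : ℝ → H → H} {a b c d : ℝ} {u v : ℝ → H}

theorem IsRightSolution.mono (hu : IsRightSolution Φ a b u) (hac : a ≤ c) (hdb : d ≤ b) :
    IsRightSolution Φ c d u :=
  ⟨hu.continuousOn.mono (Icc_subset_Icc hac hdb),
    fun t ht => hu.rightDeriv t (Ico_subset_Ico hac hdb ht)⟩

theorem IsRightSolution.comp_add_const (hu : IsRightSolution Φ a b u) (h : ℝ) :
    IsRightSolution (fun t => Φ (t + h)) (a - h) (b - h) (fun t => u (t + h)) := by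
  refine ⟨hu.continuousOn.comp (by fun_prop) fun t ht =>
    ⟨by linarith [ht.1], by linarith [ht.2]⟩, fun t ht z => ?_⟩
  have h1 := hu.rightDeriv (t + h) ⟨by linarith [ht.1], by linarith [ht.2]⟩ z
  have h2 : HasDerivWithinAt (fun s : ℝ => s + h) 1 (Ici t) t :=
    ((hasDerivAt_id t).add_const h).hasDerivWithinAt
  simpa [Function.comp_def] using h1.comp t h2 fun s hs => by
    simp only [mem_Ici] at hs ⊢; linarith

theorem IsRightSolution.sub_rightDeriv (hu : IsRightSolution Φ a b u) (hv : IsRightSolution Ψ a b v) :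
    ∀ t ∈ Ico a b, ∀ z, HasDerivWithinAt (fun s => ⟪u s - v s, z⟫)
      ⟪Φ t (u t) - Ψ t (v t), z⟫ (Ici t) t := fun t ht z => by
  simpa only [inner_sub_left] using (hu.rightDeriv t ht z).fun_sub (hv.rightDeriv t ht z)

theorem IsRightSolution.sub_const_rightDeriv (hu : IsRightSolution Φ a b u) (y : H) :
    ∀ t ∈ Ico a b, ∀ z, HasDerivWithinAt (fun s => ⟪u s - y, z⟫) ⟪Φ t (u t), z⟫ (Ici t) t :=
  fun t ht z => by
    simpa only [inner_sub_left] using (hu.rightDeriv t ht z).sub_const ⟪y, z⟫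

theorem IsRightSolution.glue (hu : IsRightSolution Φ a c u) (hv : IsRightSolution Φ c d v)
    (huv : u c = v c) : IsRightSolution Φ a d (glue c u v) := by
  refine ⟨continuousOn_glue huv hu.continuousOn hv.continuousOn, fun t ht z => ?_⟩
  rcases lt_or_ge t c with h | h
  · rw [glue_of_le u v h.le]
    refine (hu.rightDeriv t ⟨ht.1, h⟩ z).congr_of_eventuallyEq ?_ (by rw [glue_of_le u v h.le])
    filter_upwards [glue_eventuallyEq u v h] with s hs
    rw [hs]
  · rw [glue_of_ge huv h]
    exact (hv.rightDeriv t ⟨h, ht.2⟩ z).congr (fun s hs => by rw [glue_of_ge huv (h.trans hs)])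
      (by rw [glue_of_ge huv h])

variable [CompleteSpace H]

theorem IsRightSolution.eqOn (hu : IsRightSolution Φ a b u) (hv : IsRightSolution Φ a b v)
    (hdis : ∀ t ∈ Icc a b, ∀ x y, ⟪Φ t x - Φ t y, x - y⟫ ≤ 0) (huv : u a = v a) :
    EqOn u v (Icc a b) := by
  intro t ht
  have h := norm_le_add_of_inner_le (B := fun _ => 0) (B' := fun _ => 0)
    (hu.continuousOn.sub hv.continuousOn) (hu.sub_rightDeriv hv) continuousOn_const
    (fun _ _ => hasDerivWithinAt_const _ _ _) (fun _ _ => le_rfl)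
    (fun s hs => by simpa using hdis s (Ico_subset_Icc_self hs) (u s) (v s)) t ht
  simp only [Pi.sub_apply, huv, sub_self, norm_zero, add_zero] at h
  exact sub_eq_zero.1 (norm_le_zero_iff.1 h)

/-- Dissipativity replaces `Φ s (u s)` by `Φ s (u a)`, so only the field at the frozen initial state
has to be bounded. -/
theorem IsRightSolution.norm_sub_initial_le {C : ℝ} (hu : IsRightSolution Φ a b u)
    (hdis : ∀ t ∈ Icc a b, ∀ x y, ⟪Φ t x - Φ t y, x - y⟫ ≤ 0)
    (hC0 : 0 ≤ C) (hC : ∀ t ∈ Icc a b, ‖Φ t (u a)‖ ≤ C) :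
    ∀ t ∈ Icc a b, ‖u t - u a‖ ≤ C * (t - a) := by
  intro t ht
  have h := norm_le_add_of_inner_le (w := fun s => u s - u a) (B := fun s => C * s) (B' := fun _ => C)
    (hu.continuousOn.sub continuousOn_const) (hu.sub_const_rightDeriv (u a)) (by fun_prop)
    (fun s _ => by simpa using ((hasDerivAt_id s).const_mul C).hasDerivWithinAt)
    (fun s hs => by have := hs.1; gcongr) (fun s hs => ?_) t ht
  · simp only [sub_self, norm_zero] at h
    linarith
  · have hs' := Ico_subset_Icc_self hs
    have h1 := hdis s hs' (u s) (u a)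
    rw [inner_sub_left] at h1
    have h2 := (real_inner_le_norm (Φ s (u a)) (u s - u a)).trans
      (mul_le_mul_of_nonneg_right (hC s hs') (norm_nonneg _))
    linarith

end Solutions

/-! ### Bounds for the regularized equation and global existence. -/

section Regularized

variable {H : Type*} [NormedAddCommGroup H] [InnerProductSpace ℝ H]
  {F : H → H} {ε : ℝ → ℝ} {a b : ℝ} {u : ℝ → H}

/-- The dissipation inequality comparing the right-hand side at two times. -/
theorem IsMonotone.inner_Phi_sub_le (hF : IsMonotone F) {s t : ℝ} (hst : ε t ≤ ε s) (u v : H) :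
    ⟪Phi F ε t v - Phi F ε s u, v - u⟫ ≤ -ε t * ‖v - u‖ ^ 2 + (ε s - ε t) * ‖u‖ * ‖v - u‖ := by
  have e : Phi F ε t v - Phi F ε s u = -(F v - F u) - ε t • (v - u) + (ε s - ε t) • u := by
    simp only [Phi, smul_sub, sub_smul]; abel
  rw [e, inner_add_left, inner_sub_left, inner_neg_left, inner_smul_left, inner_smul_left,
    real_inner_self_eq_norm_sq, RCLike.conj_to_real, RCLike.conj_to_real]
  have h1 := hF v u
  have h2 := mul_le_mul_of_nonneg_left (real_inner_le_norm u (v - u)) (sub_nonneg.2 hst)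
  nlinarith

theorem IsMonotone.Phi_dissipative (hF : IsMonotone F) {t : ℝ} (ht : 0 ≤ ε t) (u v : H) :
    ⟪Phi F ε t u - Phi F ε t v, u - v⟫ ≤ 0 := by
  have h := hF.inner_Phi_sub_le (ε := ε) (le_refl (ε t)) v u
  nlinarith [mul_nonneg ht (sq_nonneg ‖u - v‖)]

theorem continuous_Phi_time (hε : Continuous ε) (x : H) : Continuous fun t => Phi F ε t x := by
  unfold Phi; fun_prop

theorem norm_Phi_le {t : ℝ} (ht : 0 ≤ ε t) (x : H) : ‖Phi F ε t x‖ ≤ ‖F x‖ + ε t * ‖x‖ := by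
  refine (norm_sub_le _ _).trans (le_of_eq ?_)
  rw [norm_neg, norm_smul, Real.norm_of_nonneg ht]

variable [CompleteSpace H]

theorem IsMonotone.continuous_inner_Phi (hF : IsMonotone F) (hh : IsHemicontinuous F)
    (hε : Continuous ε) (z : H) : Continuous fun p : ℝ × H => ⟪Phi F ε p.1 p.2, z⟫ := by
  have h1 : Continuous fun p : ℝ × H => ⟪F p.2, z⟫ := (hF.continuous_inner hh z).comp continuous_snd
  simp only [Phi, inner_sub_left, inner_neg_left, inner_smul_left, RCLike.conj_to_real]
  fun_prop

/-- Solutions stay bounded if the operator has a zero. -/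
theorem IsRightSolution.norm_sub_zero_le (hF : IsMonotone F) (hpos : ∀ t, 0 < ε t) {y : H}
    (hy : F y = 0) (hu : IsRightSolution (Phi F ε) a b u) {R : ℝ} (hR : ‖y‖ < R)
    (ha : ‖u a - y‖ ≤ R) : ∀ t ∈ Icc a b, ‖u t - y‖ ≤ R := by
  have hR0 : 0 < R := (norm_nonneg y).trans_lt hR
  refine norm_le_of_barrier (w := fun s => u s - y) (β' := fun _ => 0)
    (hu.continuousOn.sub continuousOn_const)
    (hu.sub_const_rightDeriv y) continuousOn_const (fun _ _ => hasDerivWithinAt_const _ _ _)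
    (fun _ _ => hR0.le) ha fun t _ h => ?_
  have e : Phi F ε t (u t) = -(F (u t) - F y) - ε t • ((u t - y) + y) := by
    simp [Phi, hy]
  rw [e, inner_sub_left, inner_neg_left, inner_smul_left, inner_add_left,
    real_inner_self_eq_norm_sq, RCLike.conj_to_real, h, zero_mul]
  have h1 := hF (u t) y
  have h2 := (abs_le.1 (abs_real_inner_le_norm y (u t - y))).1
  rw [h] at h2
  -- On the sphere of radius `R` about `y` the drift points strictly inwards because `‖y‖ < R`.
  have h3 : 0 < ε t * (R ^ 2 + ⟪y, u t - y⟫) := mul_pos (hpos t) (by nlinarith)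
  linarith

/-- Comparison of a solution with its translate in time; `E` is an antiderivative of `ε`. -/
theorem IsRightSolution.norm_shift_sub_le (hF : IsMonotone F) (hε0 : ∀ t, 0 ≤ ε t)
    (hanti : Antitone ε) {E : ℝ → ℝ} (hE : ∀ t, HasDerivAt E (ε t) t)
    (hu : IsRightSolution (Phi F ε) a b u) {M : ℝ} (hM : ∀ t ∈ Icc a b, ‖u t‖ ≤ M) {h : ℝ}
    (hh : 0 ≤ h) {t : ℝ} (hat : a ≤ t) (htb : t + h ≤ b) :
    ‖u (t + h) - u t‖ ≤ ‖u (a + h) - u a‖ + M * ((E t - E (t + h)) - (E a - E (a + h))) := by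
  have hM0 : 0 ≤ M := (norm_nonneg _).trans (hM a ⟨le_rfl, by linarith⟩)
  have hv := (hu.comp_add_const h).mono (c := a) (d := b - h) (by linarith) le_rfl
  have hu' := hu.mono (c := a) (d := b - h) le_rfl (by linarith)
  -- This derivative bounds the forcing in the equation for `u (s + h) - u s`, caused by the change
  -- of `ε`.
  have hB : ∀ s, HasDerivAt (fun s => M * (E s - E (s + h))) (M * (ε s - ε (s + h))) s := fun s =>
    ((hE s).sub ((hE (s + h)).comp_add_const s h)).const_mul M
  have hBmono : Monotone fun s => M * (E s - E (s + h)) :=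
    monotone_of_hasDerivAt_nonneg hB fun s =>
      mul_nonneg hM0 (sub_nonneg.2 (hanti (by linarith)))
  have hkey := norm_le_add_of_inner_le (w := fun s => u (s + h) - u s)
    (hv.continuousOn.sub hu'.continuousOn) (hv.sub_rightDeriv hu')
    (B := fun s => M * (E s - E (s + h)))
    (fun s _ => (hB s).continuousAt.continuousWithinAt) (fun s _ => (hB s).hasDerivWithinAt)
    (fun s hs => hBmono hs.1) (fun s hs => ?_) t ⟨hat, by linarith⟩
  · linarith
  · have hle : ε (s + h) ≤ ε s := hanti (by linarith)
    have h1 := hF.inner_Phi_sub_le hle (u s) (u (s + h))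
    have h2 : (ε s - ε (s + h)) * ‖u s‖ ≤ (ε s - ε (s + h)) * M :=
      mul_le_mul_of_nonneg_left (hM s ⟨hs.1, by linarith [hs.2]⟩) (sub_nonneg.2 hle)
    have h3 := mul_le_mul_of_nonneg_right h2 (norm_nonneg (u (s + h) - u s))
    have h4 := mul_nonneg (hε0 (s + h)) (sq_nonneg ‖u (s + h) - u s‖)
    linarith

/-- Solutions are Lipschitz, with a constant independent of the length of the interval. -/
theorem IsRightSolution.norm_sub_le_mul (hF : IsMonotone F) (hε : Continuous ε)
    (hε0 : ∀ t, 0 ≤ ε t) (hanti : Antitone ε)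
    (hu : IsRightSolution (Phi F ε) a b u) {M : ℝ} (hM : ∀ t ∈ Icc a b, ‖u t‖ ≤ M) {s t : ℝ}
    (has : a ≤ s) (hst : s ≤ t) (htb : t ≤ b) :
    ‖u t - u s‖ ≤ (‖F (u a)‖ + 2 * (ε a * M)) * (t - s) := by
  set E : ℝ → ℝ := fun t => ∫ r in a..t, ε r
  have hE : ∀ t, HasDerivAt E (ε t) t := fun t => (hε.integral_hasStrictDerivAt a t).hasDerivAt
  have hma : ‖u a‖ ≤ M := hM a ⟨le_rfl, has.trans (hst.trans htb)⟩
  have hM0 : 0 ≤ M := (norm_nonneg _).trans hma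
  have hh : 0 ≤ t - s := sub_nonneg.2 hst
  -- The increment over `[s, t]` is compared with that over the initial interval of the same length,
  -- which is controlled by the field at `u a`; the forcing adds the second `ε a * M`.
  have h1 := hu.norm_shift_sub_le hF hε0 hanti hE hM hh has (by linarith)
  rw [add_sub_cancel] at h1
  have hεa : 0 ≤ ε a * M := mul_nonneg (hε0 a) hM0
  have h2 := hu.norm_sub_initial_le (fun τ _ => hF.Phi_dissipative (hε0 τ))
    (C := ‖F (u a)‖ + ε a * M) (by positivity) (fun τ hτ => (norm_Phi_le (hε0 τ) _).trans
      (by have := hanti hτ.1; have := hε0 a; gcongr)) (a + (t - s)) ⟨by linarith, by linarith⟩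
  have hEmono : Monotone E := monotone_of_hasDerivAt_nonneg hE hε0
  have h3 : E (a + (t - s)) - E a ≤ ε a * (t - s) := by
    have := image_le_of_deriv_right_le_deriv_boundary (f := E) (f' := ε) (a := a)
      (b := a + (t - s)) (B := fun r => E a + ε a * (r - a)) (B' := fun _ => ε a)
      (fun r _ => (hE r).continuousAt.continuousWithinAt) (fun r _ => (hE r).hasDerivWithinAt)
      (by simp) (by fun_prop)
      (fun r _ => by simpa using
        ((((hasDerivAt_id r).sub_const a).const_mul (ε a)).const_add (E a)).hasDerivWithinAt)
      (fun r hr => hanti hr.1) (right_mem_Icc.2 (by linarith : a ≤ a + (t - s)))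
    simp only [add_sub_cancel_left] at this
    linarith
  have h4 : E s ≤ E t := hEmono hst
  have h5 : M * ((E s - E t) - (E a - E (a + (t - s)))) ≤ M * (ε a * (t - s)) := by
    gcongr; linarith
  simp only [add_sub_cancel_left] at h2
  linarith

/-- Around every point, local solutions exist for a time bounded from below. -/
theorem IsMonotone.exists_extension_time (hF : IsMonotone F) (hh : IsHemicontinuous F)
    (hε : Continuous ε) (hε0 : ∀ t, 0 ≤ ε t) (hanti : Antitone ε) (x : H) :
    ∃ ρ > 0, ∃ τ > 0, ∀ x', ‖x' - x‖ ≤ ρ → ∀ a, 0 ≤ a →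
      ∃ u, u a = x' ∧ IsRightSolution (Phi F ε) a (a + τ) u := by
  obtain ⟨r, hr, K₀, hK₀⟩ := hF.locally_bounded x
  have hK0 : 0 ≤ K₀ := (norm_nonneg _).trans (hK₀ x (by simpa using hr.le))
  have hε00 := hε0 0
  set K := K₀ + ε 0 * (‖x‖ + r) with hKdef
  have hK : 0 ≤ K := by positivity
  -- Balls of radius `r / 2` about `x'` stay in the ball of radius `r` about `x`, where `F` is
  -- bounded.
  refine ⟨r / 2, by positivity, r / 2 / (K + 1), by positivity, fun x' hx' a ha => ?_⟩
  refine exists_local_solution (K := K) (r := r / 2) (hF.continuous_inner_Phi hh hε)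
    (continuous_Phi_time hε)
    (fun t _ => hF.Phi_dissipative (hε0 t)) (fun t ht ξ hξ => ?_) hK
    (by simp; positivity) ?_
  · have h1 : ‖ξ - x‖ ≤ r := by
      have := norm_sub_le_norm_sub_add_norm_sub ξ x' x
      linarith
    have h2 : ‖ξ‖ ≤ ‖x‖ + r := by
      have := norm_le_norm_add_norm_sub' ξ x
      linarith
    refine (norm_Phi_le (hε0 t) ξ).trans ?_
    have h3 : ε t ≤ ε 0 := hanti (ha.trans ht.1)
    have h4 := hK₀ ξ h1
    rw [hKdef]; gcongr
  · rw [add_sub_cancel_left, mul_div_assoc', div_le_iff₀ (by positivity)]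
    nlinarith

/-- `F` need not be bounded on bounded sets, so boundedness of `u` does not suffice for
continuation. The uniform Lipschitz bound gives a limit state at a maximal time, and near that state
the existence time is bounded below. -/
theorem IsMonotone.exists_solution_Icc (hF : IsMonotone F) (hh : IsHemicontinuous F)
    (hε : Continuous ε) (hpos : ∀ t, 0 < ε t) (hanti : Antitone ε) {y : H} (hy : F y = 0)
    (u₀ : H) (T : ℝ) : ∃ u, u 0 = u₀ ∧ IsRightSolution (Phi F ε) 0 T u := by
  have hε0 : ∀ t, 0 ≤ ε t := fun t => (hpos t).le
  set R := ‖u₀ - y‖ + ‖y‖ + 1 with hR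
  set M := R + ‖y‖ with hM
  set L := ‖F u₀‖ + 2 * (ε 0 * M) with hL
  have hL0 : 0 ≤ L := by have := hε0 0; positivity
  have hlip : ∀ {T u}, u 0 = u₀ → IsRightSolution (Phi F ε) 0 T u → ∀ {s t}, 0 ≤ s → s ≤ t → t ≤ T →
      ‖u t - u s‖ ≤ L * (t - s) := by
    intro T u h0 hu s t hs hst ht
    have hb := hu.norm_sub_zero_le hF hpos hy (R := R) (by linarith [norm_nonneg (u₀ - y)])
      (by rw [h0]; linarith [norm_nonneg y])
    have h := hu.norm_sub_le_mul hF hε hε0 hanti (M := M) (fun τ hτ => by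
      have := norm_le_norm_add_norm_sub' (u τ) y
      linarith [hb τ hτ]) hs hst ht
    rwa [h0] at h
  by_contra hT
  set S : Set ℝ := {T | ∃ u, u 0 = u₀ ∧ IsRightSolution (Phi F ε) 0 T u} with hS
  have hdown : ∀ {T T'}, T' ≤ T → T ∈ S → T' ∈ S := fun h ⟨u, h0, hu⟩ => ⟨u, h0, hu.mono le_rfl h⟩
  have hzero : (0 : ℝ) ∈ S := ⟨fun _ => u₀, rfl, continuousOn_const, fun t ht => by simp at ht⟩
  have hbdd : BddAbove S := ⟨T, fun T' h' => le_of_not_gt fun h => hT (hdown h.le h')⟩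
  set m := sSup S with hm
  have hm0 : 0 ≤ m := le_csSup hbdd hzero
  obtain ⟨T', -, hTlim, hTS⟩ := exists_seq_tendsto_sSup ⟨0, hzero⟩ hbdd
  have hTm : ∀ n, max (T' n) 0 ≤ m := fun n => max_le (le_csSup hbdd (hTS n)) hm0
  -- Negative horizons belong to `S` vacuously; truncation discards them.
  set P : ℕ → ℝ := fun n => max (T' n) 0 with hP
  have hPlim : Tendsto P atTop (𝓝 m) := by
    have := hTlim.max (tendsto_const_nhds (x := (0 : ℝ)))
    rwa [← hm, max_eq_left hm0] at this
  have hP0 : ∀ n, 0 ≤ P n := fun n => le_max_right _ _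
  have hPS : ∀ n, P n ∈ S := fun n => by
    rcases max_choice (T' n) 0 with h | h <;> simp only [P, h]
    exacts [hTS n, hzero]
  choose w hw0 hw using hPS
  have hdist : ∀ i j, P i ≤ P j → ‖w j (P j) - w i (P i)‖ ≤ L * (P j - P i) := by
    intro i j hij
    have h := (hw i).eqOn ((hw j).mono le_rfl hij) (fun t _ => hF.Phi_dissipative (hε0 t))
      ((hw0 i).trans (hw0 j).symm) (right_mem_Icc.2 (hP0 i))
    rw [h]
    exact hlip (hw0 j) (hw j) (hP0 i) hij le_rfl
  have hcau : CauchySeq fun n => w n (P n) := by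
    refine Metric.cauchySeq_iff.2 fun η hη => ?_
    obtain ⟨N, hN⟩ := Metric.cauchySeq_iff.1 hPlim.cauchySeq (η / (L + 1)) (by positivity)
    refine ⟨N, fun i hi j hj => ?_⟩
    have h1 : dist (w i (P i)) (w j (P j)) ≤ L * |P i - P j| := by
      rcases le_total (P i) (P j) with h | h
      · rw [dist_comm, dist_eq_norm, abs_sub_comm, abs_of_nonneg (sub_nonneg.2 h)]
        exact hdist i j h
      · rw [dist_eq_norm, abs_of_nonneg (sub_nonneg.2 h)]
        exact hdist j i h
    have h2 := hN i hi j hj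
    rw [Real.dist_eq, lt_div_iff₀ (by positivity)] at h2
    nlinarith [abs_nonneg (P i - P j)]
  obtain ⟨x, hx⟩ := cauchySeq_tendsto_of_complete hcau
  obtain ⟨ρ, hρ, τ, hτ, hext⟩ := hF.exists_extension_time hh hε hε0 hanti x
  -- Restarting at `P n > m - τ` from a state close to `x` overshoots the supremum `m`.
  obtain ⟨n, hn1, hn2⟩ := ((hx.eventually (Metric.closedBall_mem_nhds x hρ)).and
    (hPlim.eventually_const_lt (show m - τ < m by linarith))).exists
  obtain ⟨v, hv0, hv⟩ := hext (w n (P n)) (by simpa [dist_eq_norm] using hn1) (P n) (hP0 n)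
  have : P n + τ ∈ S := ⟨glue (P n) (w n) v, by rw [glue_of_le _ _ (hP0 n), hw0 n],
    (hw n).glue hv hv0.symm⟩
  linarith [le_csSup hbdd this]

/-- Global existence. -/
theorem IsMonotone.exists_global_solution (hF : IsMonotone F) (hh : IsHemicontinuous F)
    (hε : Continuous ε) (hpos : ∀ t, 0 < ε t) (hanti : Antitone ε) {y : H} (hy : F y = 0)
    (u₀ : H) : ∃ u, u 0 = u₀ ∧ ∀ T, IsRightSolution (Phi F ε) 0 T u := by
  choose w hw0 hw using hF.exists_solution_Icc hh hε hpos hanti hy u₀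
  have heq : ∀ T, EqOn (fun t => w t t) (w T) (Icc 0 T) := fun T t ht =>
    (hw t).eqOn ((hw T).mono le_rfl ht.2) (fun s _ => hF.Phi_dissipative (hpos s).le)
      ((hw0 t).trans (hw0 T).symm) (right_mem_Icc.2 ht.1)
  refine ⟨fun t => w t t, hw0 0, fun T => ⟨(hw T).continuousOn.congr (heq T), fun t ht z => ?_⟩⟩
  rw [show w t t = w T t from heq T (Ico_subset_Icc_self ht)]
  refine ((hw T).rightDeriv t ht z).congr_of_eventuallyEq ?_ (by
    rw [show w t t = w T t from heq T (Ico_subset_Icc_self ht)])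
  filter_upwards [Icc_mem_nhdsGE ht.2] with s hs
  rw [show w s s = w T s from heq T ⟨ht.1.trans hs.1, hs.2⟩]

end Regularized

/-! ### From weak to norm derivatives. -/

section Regularity

variable {H : Type*} [NormedAddCommGroup H] [InnerProductSpace ℝ H]
  {F : H → H} {ε : ℝ → ℝ} {u : ℝ → H}

theorem tendsto_norm_slope_of_hasDerivWithinAt {d : H} {t : ℝ}
    (h : HasDerivWithinAt u d (Ici t) t) :
    Tendsto (fun h : ℝ => ‖u (t + h) - u t‖ / h) (𝓝[>] 0) (𝓝 ‖d‖) := by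
  have h1 := (hasDerivWithinAt_iff_tendsto_slope' (s := Ioi t) (x := t) (by simp)).1
    (h.mono Ioi_subset_Ici_self)
  have h2 : Tendsto (fun h : ℝ => t + h) (𝓝[>] 0) (𝓝[>] t) := by
    refine tendsto_nhdsWithin_iff.2 ⟨?_, ?_⟩
    · have : Continuous fun h : ℝ => t + h := by fun_prop
      simpa using (this.tendsto 0).mono_left nhdsWithin_le_nhds
    · filter_upwards [self_mem_nhdsWithin] with h hh
      have hh : 0 < h := hh
      simp [hh]
  refine (h1.comp h2).norm.congr' ?_
  filter_upwards [self_mem_nhdsWithin] with h hh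
  have hh : 0 < h := hh
  simp [slope, norm_smul, abs_of_pos hh, div_eq_inv_mul]

theorem continuousOn_Ici_of_forall_isRightSolution {Φ : ℝ → H → H}
    (hu : ∀ T, IsRightSolution Φ 0 T u) : ContinuousOn u (Ici 0) := fun t ht =>
  ((hu (t + 1)).continuousOn t ⟨ht, by linarith⟩).mono_of_mem_nhdsWithin (by
    filter_upwards [self_mem_nhdsWithin,
      nhdsWithin_le_nhds (Iio_mem_nhds (show t < t + 1 by linarith))] with s h1 h2
    exact ⟨h1, le_of_lt h2⟩)

/-- A solution with weak right derivatives has two-sided weak derivatives. -/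
theorem hasDerivWithinAt_inner_of_isRightSolution {Φ : ℝ → H → H}
    (hdemi : ∀ z, Continuous fun p : ℝ × H => ⟪Φ p.1 p.2, z⟫)
    (hu : ∀ T, IsRightSolution Φ 0 T u) {t : ℝ} (ht : 0 ≤ t) (z : H) :
    HasDerivWithinAt (fun s => ⟪u s, z⟫) ⟪Φ t (u t), z⟫ (Ici 0) t := by
  have hcu : Continuous fun s => u (max s 0) :=
    (continuousOn_Ici_of_forall_isRightSolution hu).comp_continuous (by fun_prop)
      fun s => le_max_right s 0
  set ψ : ℝ → ℝ := fun s => ⟪Φ s (u (max s 0)), z⟫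
  have hψ : Continuous ψ := (hdemi z).comp (continuous_id.prodMk hcu)
  -- `ψ` is continuous, so its primitive `G` is two-sided differentiable; it has the same right
  -- derivative as `⟪u, z⟫`, hence equals it.
  set G : ℝ → ℝ := fun s => ⟪u 0, z⟫ + ∫ r in (0 : ℝ)..s, ψ r
  have hG : ∀ s, HasDerivAt G (ψ s) s := fun s =>
    (hψ.integral_hasStrictDerivAt 0 s).hasDerivAt.const_add _
  have heq : ∀ s, 0 ≤ s → ⟪u s, z⟫ = G s := fun s hs => by
    have h := constant_of_has_deriv_right_zero (f := fun s => ⟪u s, z⟫ - G s) (a := 0) (b := s)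
      (((hu s).continuousOn.inner continuousOn_const).sub
        fun r _ => (hG r).continuousAt.continuousWithinAt)
      (fun r hr => by
        have h1 := ((hu s).rightDeriv r hr z).fun_sub (hG r).hasDerivWithinAt
        rwa [show ψ r = ⟪Φ r (u r), z⟫ by simp [ψ, max_eq_left hr.1], sub_self] at h1)
      s (right_mem_Icc.2 hs)
    have hG0 : G 0 = ⟪u 0, z⟫ := by simp [G]
    rw [hG0, sub_self] at h
    exact sub_eq_zero.1 h
  have h1 := (hG t).hasDerivWithinAt (s := Ici 0)
  rw [show ψ t = ⟪Φ t (u t), z⟫ by simp [ψ, max_eq_left ht]] at h1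
  exact h1.congr (fun s hs => heq s hs) (heq t ht)

variable [CompleteSpace H]

/-- Solutions of a dissipative equation are right differentiable in norm. -/
theorem IsRightSolution.hasDerivWithinAt_Ici {Φ : ℝ → H → H} {a b t : ℝ}
    (hu : IsRightSolution Φ a b u)
    (hdis : ∀ t ∈ Icc a b, ∀ x y, ⟪Φ t x - Φ t y, x - y⟫ ≤ 0)
    (hc : ∀ ξ, Continuous fun t => Φ t ξ) (ht : t ∈ Ico a b) :
    HasDerivWithinAt u (Φ t (u t)) (Ici t) t := by
  refine hasDerivWithinAt_of_weak (hu.rightDeriv t ht _) fun η hη => ?_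
  have h1 : ∀ᶠ s in 𝓝 t, ‖Φ s (u t)‖ < ‖Φ t (u t)‖ + η :=
    (hc (u t)).norm.continuousAt.eventually_lt_const (by linarith)
  obtain ⟨e, he, hes⟩ := 
    mem_nhdsGE_iff_exists_Icc_subset.1 (nhdsWithin_le_nhds (s := Ici t) h1)
  have hm : t < min e b := lt_min he ht.2
  filter_upwards [Icc_mem_nhdsGE hm] with s hs
  rw [abs_of_nonneg (sub_nonneg.2 hs.1)]
  refine (hu.mono ht.1 (min_le_right e b)).norm_sub_initial_le
    (fun r hr => hdis r ⟨ht.1.trans hr.1, hr.2.trans (min_le_right _ _)⟩) (by positivity)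
    (fun r hr => ?_) s hs
  exact le_of_lt (hes ⟨hr.1, hr.2.trans (min_le_left _ _)⟩)

/-- The speed of a bounded solution decreases up to a multiple of `ε`. -/
theorem antitoneOn_norm_Phi_add (hF : IsMonotone F) (hε : Continuous ε) (hε0 : ∀ t, 0 ≤ ε t)
    (hanti : Antitone ε) (hu : ∀ T, IsRightSolution (Phi F ε) 0 T u) {M : ℝ}
    (hM : ∀ t, 0 ≤ t → ‖u t‖ ≤ M) :
    AntitoneOn (fun t => ‖Phi F ε t (u t)‖ + M * ε t) (Ici 0) := by
  intro s hs t ht hst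
  have hs : 0 ≤ s := hs
  have ht : 0 ≤ t := ht
  set E : ℝ → ℝ := fun t => ∫ r in (0 : ℝ)..t, ε r
  have hE : ∀ t, HasDerivAt E (ε t) t := fun t => (hε.integral_hasStrictDerivAt 0 t).hasDerivAt
  have hstrong : ∀ r, 0 ≤ r → HasDerivWithinAt u (Phi F ε r (u r)) (Ici r) r := fun r hr =>
    (hu (r + 1)).hasDerivWithinAt_Ici (fun τ _ => hF.Phi_dissipative (hε0 τ))
      (continuous_Phi_time hε) ⟨hr, by linarith⟩
  have hEs : ∀ r, Tendsto (fun h => (E (r + h) - E r) / h) (𝓝[>] 0) (𝓝 (ε r)) := fun r => by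
    simpa [div_eq_inv_mul] using (hE r).tendsto_slope_zero_right
  have hlim := (tendsto_norm_slope_of_hasDerivWithinAt (hstrong s hs)).add
    (((hEs s).sub (hEs t)).const_mul M)
  -- Dividing the shift estimate by `h` and letting `h → 0` turns increments into speeds.
  have hle := le_of_tendsto_of_tendsto (tendsto_norm_slope_of_hasDerivWithinAt (hstrong t ht)) hlim (by
    filter_upwards [self_mem_nhdsWithin] with h hh
    have hh : 0 < h := hh
    have h1 := ((hu (t + h)).mono hs le_rfl).norm_shift_sub_le hF hε0 hanti hE
      (fun r hr => hM r (hs.trans hr.1)) hh.le hst le_rfl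
    rw [div_sub_div_same, mul_div_assoc', ← add_div]
    gcongr
    linarith)
  show ‖Phi F ε t (u t)‖ + M * ε t ≤ ‖Phi F ε s (u s)‖ + M * ε s
  linarith

/-- Bounded solutions are differentiable in norm at all but countably many times. -/
theorem countable_not_hasDerivAt (hF : IsMonotone F) (hh : IsHemicontinuous F) (hε : Continuous ε)
    (hε0 : ∀ t, 0 ≤ ε t) (hanti : Antitone ε) (hu : ∀ T, IsRightSolution (Phi F ε) 0 T u) {M : ℝ}
    (hM : ∀ t, 0 ≤ t → ‖u t‖ ≤ M) :
    {t | 0 < t ∧ ¬ HasDerivAt u (Phi F ε t (u t)) t}.Countable := by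
  -- A monotone function has countably many discontinuities. Where the speed is continuous, it
  -- bounds difference quotients on both sides by nearly `‖Phi F ε t (u t)‖`, which upgrades the
  -- weak derivative.
  refine (antitoneOn_norm_Phi_add hF hε hε0 hanti hu
    hM).countable_not_continuousWithinAt.mono fun t ht => ?_
  obtain ⟨ht0, htd⟩ := ht
  refine ⟨ht0.le, fun hcont => htd ?_⟩
  have hcont : ContinuousAt (fun t => ‖Phi F ε t (u t)‖) t := by
    have h1 := (hcont.continuousAt (Ici_mem_nhds ht0)).fun_sub (hε.continuousAt.const_mul M)
    simpa using h1
  rw [← hasDerivWithinAt_univ]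
  refine hasDerivWithinAt_of_weak (((hasDerivWithinAt_inner_of_isRightSolution
    (hF.continuous_inner_Phi hh hε) hu ht0.le _).hasDerivAt
      (Ici_mem_nhds ht0)).hasDerivWithinAt) fun η hη => ?_
  rw [nhdsWithin_univ]
  obtain ⟨ρ, hρ, hball⟩ := Metric.eventually_nhds_iff_ball.1
    ((hcont.eventually_lt_const (show ‖Phi F ε t (u t)‖ < ‖Phi F ε t (u t)‖ + η by linarith)).and
      (eventually_gt_nhds ht0))
  have hseg : ∀ s₁ ∈ Metric.ball t ρ, ∀ s₂ ∈ Metric.ball t ρ, s₁ ≤ s₂ →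
      ‖u s₂ - u s₁‖ ≤ (‖Phi F ε t (u t)‖ + η) * (s₂ - s₁) := by
    intro s₁ h₁ s₂ h₂ h₁₂
    have hsub : Icc s₁ s₂ ⊆ Metric.ball t ρ := (convex_ball t ρ).ordConnected.out h₁ h₂
    have hpos := (hball s₁ h₁).2
    refine norm_image_sub_le_of_norm_deriv_right_le_segment (f' := fun r => Phi F ε r (u r))
      ((hu s₂).continuousOn.mono (Icc_subset_Icc_left hpos.le)) (fun r hr => ?_)
      (fun r hr => (hball r (hsub (Ico_subset_Icc_self hr))).1.le) s₂ (right_mem_Icc.2 h₁₂)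
    exact (hu s₂).hasDerivWithinAt_Ici (fun τ _ => hF.Phi_dissipative (hε0 τ))
      (continuous_Phi_time hε) ⟨hpos.le.trans hr.1, hr.2⟩
  filter_upwards [Metric.ball_mem_nhds t hρ] with s hs
  rcases le_total t s with h | h
  · rw [abs_of_nonneg (sub_nonneg.2 h)]
    exact hseg t (Metric.mem_ball_self hρ) s hs h
  · rw [abs_sub_comm, abs_of_nonneg (sub_nonneg.2 h), norm_sub_rev]
    exact hseg s hs t (Metric.mem_ball_self hρ) h

end Regularity

/-! ### The speed is `o(ε)`. -/

section Decay

variable {H : Type*} [NormedAddCommGroup H] [InnerProductSpace ℝ H] [CompleteSpace H]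
  {F : H → H} {ε : ℝ → ℝ} {u : ℝ → H}

theorem sub_le_of_abs_deriv_le (hε : Continuous ε) (hpos : ∀ t, 0 < ε t) (hanti : Antitone ε)
    {κ s₀ : ℝ} (hd : ∀ t, s₀ ≤ t → DifferentiableAt ℝ ε t)
    (hrate : ∀ t, s₀ ≤ t → |deriv ε t| ≤ κ * ε t ^ 2) (hκ : 0 ≤ κ) {s h : ℝ} (hs : s₀ ≤ s)
    (hh : 0 < h) : ε s - ε (s + h) ≤ h * (κ * ε s ^ 2) := by
  obtain ⟨c, hc, hcd⟩ := exists_deriv_eq_slope ε (show s < s + h by linarith) hε.continuousOn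
    fun t ht => (hd t (hs.trans ht.1.le)).differentiableWithinAt
  rw [add_sub_cancel_left, eq_div_iff hh.ne'] at hcd
  have h1 := (abs_le.1 (hrate c (hs.trans hc.1.le))).1
  have h2 : κ * ε c ^ 2 ≤ κ * ε s ^ 2 := by
    have := (hpos c).le
    have := hanti hc.1.le
    gcongr
  nlinarith

/-- The speed of a bounded solution is eventually small compared with `ε`, quantitatively. -/
theorem norm_Phi_le_of_rate (hF : IsMonotone F) (hε : Continuous ε)
    (hpos : ∀ t, 0 < ε t) (hanti : Antitone ε) (hu : ∀ T, IsRightSolution (Phi F ε) 0 T u)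
    {M κ s₀ : ℝ} (hM0 : 0 < M) (hM : ∀ t, 0 ≤ t → ‖u t‖ ≤ M) (hκ : 0 < κ) (hκ8 : κ ≤ 1 / 8)
    (hs₀ : 0 ≤ s₀) (hd : ∀ t, s₀ ≤ t → DifferentiableAt ℝ ε t)
    (hrate : ∀ t, s₀ ≤ t → |deriv ε t| ≤ κ * ε t ^ 2) :
    ∃ D, ∀ t, s₀ ≤ t → ‖Phi F ε t (u t)‖ ≤ 4 * M * κ * ε t + D * ε t ^ 2 := by
  have hstrong : ∀ r, 0 ≤ r → HasDerivWithinAt u (Phi F ε r (u r)) (Ici r) r := fun r hr =>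
    (hu (r + 1)).hasDerivWithinAt_Ici (fun τ _ => hF.Phi_dissipative (hpos τ).le)
      (continuous_Phi_time hε) ⟨hr, by linarith⟩
  -- `D * ε ^ 2` dominates the difference quotients at `s₀`, with slack `1` for small `h`.
  set D := (‖Phi F ε s₀ (u s₀)‖ + 1) / ε s₀ ^ 2 with hD
  have hε₀ := hpos s₀
  have hD0 : 0 < D := by positivity
  refine ⟨D, fun t ht => ?_⟩
  have hsmall : ∀ᶠ h : ℝ in 𝓝[>] 0, h * (κ * ε s₀) ≤ 1 / 2 := by
    have : Continuous fun h : ℝ => h * (κ * ε s₀) := by fun_prop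
    have h1 := (this.tendsto 0).mono_left (nhdsWithin_le_nhds (s := Ioi 0))
    rw [zero_mul] at h1
    exact (h1.eventually_lt_const (by norm_num)).mono fun _ => le_of_lt
  have hstart : ∀ᶠ h : ℝ in 𝓝[>] 0, ‖u (s₀ + h) - u s₀‖ / h ≤ ‖Phi F ε s₀ (u s₀)‖ + 1 :=
    ((tendsto_norm_slope_of_hasDerivWithinAt (hstrong s₀ hs₀)).eventually_lt_const
      (by linarith)).mono fun _ => le_of_lt
  refine le_of_tendsto (tendsto_norm_slope_of_hasDerivWithinAt (hstrong t (hs₀.trans ht))) ?_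
  filter_upwards [hsmall, hstart, self_mem_nhdsWithin] with h h1 h2 hh
  have hh : 0 < h := hh
  rw [div_le_iff₀ hh] at h2 ⊢
  have hv := ((hu (t + h)).comp_add_const h).mono (c := s₀) (d := t) (by linarith) (by linarith)
  have hu' := (hu t).mono (c := s₀) (d := t) hs₀ le_rfl
  have hβpos : ∀ s, 0 < (4 * M * κ * ε s + D * ε s ^ 2) * h := fun s => by
    have := hpos s; positivity
  -- The term `4 * M * κ * ε` absorbs the forcing `M * κ * ε ^ 2`, and `D * ε ^ 2` the initial
  -- speed. The barrier decays at relative rate at most `2 * κ * ε ≤ ε / 4`, slower than the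
  -- contraction rate `ε (s + h) ≥ ε s / 2`.
  refine norm_le_of_barrier (w := fun s => u (s + h) - u s)
    (β := fun s => (4 * M * κ * ε s + D * ε s ^ 2) * h)
    (β' := fun s => (4 * M * κ + 2 * D * ε s) * deriv ε s * h)
    (hv.continuousOn.sub hu'.continuousOn) (hv.sub_rightDeriv hu') (by fun_prop)
    (fun s hs => ?_) (fun s _ => (hβpos s).le) (h2.trans ?_) (fun s hs hws => ?_) t
    (right_mem_Icc.2 ht)
  · have h3 := (hd s hs.1).hasDerivAt
    have h4 := ((h3.const_mul (4 * M * κ)).fun_add ((h3.fun_pow 2).const_mul D)).mul_const h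
    refine (h4.congr_deriv ?_).hasDerivWithinAt
    rw [show (2 - 1 : ℕ) = 1 from rfl]
    push_cast
    ring
  · refine mul_le_mul_of_nonneg_right ?_ hh.le
    have h3 : D * ε s₀ ^ 2 = ‖Phi F ε s₀ (u s₀)‖ + 1 := by rw [hD]; field_simp
    have : 0 ≤ 4 * M * κ * ε s₀ := by positivity
    linarith
  · have hle : ε (s + h) ≤ ε s := hanti (by linarith)
    have hεs := hpos s
    have hsub := sub_le_of_abs_deriv_le hε hpos hanti hd hrate hκ.le hs.1 hh
    have hhalf : ε s / 2 ≤ ε (s + h) := by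
      have h4 : h * (κ * ε s) ≤ 1 / 2 := le_trans (by have := hanti hs.1; gcongr) h1
      nlinarith
    have h3 := hF.inner_Phi_sub_le hle (u s) (u (s + h))
    have hβ := hβpos s
    set β := (4 * M * κ * ε s + D * ε s ^ 2) * h with hβdef
    have hws' : ‖u (s + h) - u s‖ = β := hws
    rw [hws'] at h3
    have hd' := (abs_le.1 (hrate s hs.1)).1
    have h5 : (ε s - ε (s + h)) * ‖u s‖ ≤ h * (κ * ε s ^ 2) * M :=
      mul_le_mul hsub (hM s (hs₀.trans hs.1)) (norm_nonneg _) (by positivity)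
    have h6 : -((4 * M * κ + 2 * D * ε s) * (κ * ε s ^ 2) * h)
        ≤ (4 * M * κ + 2 * D * ε s) * deriv ε s * h := by
      rw [← neg_mul, ← mul_neg]; gcongr
    have h7 : h * (κ * ε s ^ 2) * M + (4 * M * κ + 2 * D * ε s) * (κ * ε s ^ 2) * h
        < ε s / 2 * β := by
      have e1 : ε s / 2 * β - (h * (κ * ε s ^ 2) * M + (4 * M * κ + 2 * D * ε s) * (κ * ε s ^ 2) * h)
          = h * ε s ^ 2 * (M * κ * (1 - 4 * κ) + D * ε s * (1 / 2 - 2 * κ)) := by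
        rw [hβdef]; ring
      have e2 : 0 < h * ε s ^ 2 * (M * κ * (1 - 4 * κ) + D * ε s * (1 / 2 - 2 * κ)) := by
        have : 0 < 1 - 4 * κ := by linarith
        have : 0 < 1 / 2 - 2 * κ := by linarith
        positivity
      linarith
    have h8 : ε s / 2 * β ≤ ε (s + h) * β := by gcongr
    refine lt_of_le_of_lt h3 ?_
    have h9 : -ε (s + h) * β + (ε s - ε (s + h)) * ‖u s‖
        < (4 * M * κ + 2 * D * ε s) * deriv ε s * h := by linarith
    have h10 := mul_lt_mul_of_pos_right h9 hβ
    linarith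

theorem eventually_norm_Phi_le (hF : IsMonotone F) (hε : Continuous ε)
    (hpos : ∀ t, 0 < ε t) (hanti : Antitone ε) (hd : ∀ t, 0 < t → DifferentiableAt ℝ ε t)
    (hzero : Tendsto ε atTop (𝓝 0))
    (hrate : Tendsto (fun t => deriv ε t / ε t ^ 2) atTop (𝓝 0))
    (hu : ∀ T, IsRightSolution (Phi F ε) 0 T u)
    {M : ℝ} (hM : ∀ t, 0 ≤ t → ‖u t‖ ≤ M) {η : ℝ} (hη : 0 < η) :
    ∀ᶠ t in atTop, ‖Phi F ε t (u t)‖ ≤ η * ε t := by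
  have hM0 : 0 ≤ M := (norm_nonneg _).trans (hM 0 le_rfl)
  -- With `M + 1`, which is positive, as the bound on `u`, the linear term is at most `η / 2 * ε`;
  -- the quadratic one is eventually as small.
  set κ := min (1 / 8) (η / (8 * (M + 1))) with hκdef
  have hκ : 0 < κ := by positivity
  have hκη : κ * (8 * (M + 1)) ≤ η := by
    rw [← le_div_iff₀ (by positivity)]; exact min_le_right _ _
  have hev : ∀ᶠ t in atTop, |deriv ε t| ≤ κ * ε t ^ 2 := by
    filter_upwards [(tendsto_zero_iff_abs_tendsto_zero _).1 hrate |>.eventually_lt_const hκ] with t ht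
    have h1 := hpos t
    simp only [Function.comp, abs_div, abs_of_pos (pow_pos h1 2)] at ht
    rw [div_lt_iff₀ (by positivity)] at ht
    exact ht.le
  obtain ⟨s₀, hs₀⟩ := eventually_atTop.1 (hev.and (eventually_gt_atTop 0))
  obtain ⟨D, hD⟩ := norm_Phi_le_of_rate hF hε hpos hanti hu (M := M + 1) (by positivity)
    (fun t ht => (hM t ht).trans (by linarith)) hκ (min_le_left _ _) (hs₀ s₀ le_rfl).2.le
    (fun t ht => hd t (hs₀ t ht).2) (fun t ht => (hs₀ t ht).1)
  have hsm : Tendsto (fun t => D * ε t) atTop (𝓝 0) := by simpa using hzero.const_mul D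
  filter_upwards [eventually_ge_atTop s₀,
    hsm.eventually_lt_const (show 0 < η / 2 by positivity)] with t ht h2
  have h1 := hpos t
  nlinarith [hD t ht]

end Decay

/-! ### Strong convergence to the minimal norm zero. -/

section Convergence

variable {H : Type*} [NormedAddCommGroup H] [InnerProductSpace ℝ H]
  {F : H → H} {ε : ℝ → ℝ} {u : ℝ → H}

/-- Minty's lemma, for weak limits. -/
theorem IsMonotone.eq_zero_of_weak_limit {α : Type*} {l : Filter α} [l.NeBot] (hF : IsMonotone F)
    (hh : IsHemicontinuous F) {u : α → H} {M : ℝ} (hM : ∀ᶠ t in l, ‖u t‖ ≤ M) {x : H}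
    (hx : ∀ z, Tendsto (fun t => ⟪u t, z⟫) l (𝓝 ⟪x, z⟫))
    (hFu : Tendsto (fun t => F (u t)) l (𝓝 0)) : F x = 0 := by
  have hvar : ∀ v, 0 ≤ ⟪F v, v - x⟫ := by
    intro v
    have h1 : Tendsto (fun t => ⟪F (u t), u t - v⟫) l (𝓝 0) := by
      refine squeeze_zero_norm' (a := fun t => ‖F (u t)‖ * (M + ‖v‖)) ?_ ?_
      · filter_upwards [hM] with t ht
        refine (norm_inner_le_norm _ _).trans ?_
        gcongr
        exact (norm_sub_le _ _).trans (by gcongr)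
      · simpa using hFu.norm.mul_const (M + ‖v‖)
    have h2 : Tendsto (fun t => ⟪F (u t), u t - v⟫ - (⟪u t, F v⟫ - ⟪v, F v⟫)) l
        (𝓝 (0 - (⟪x, F v⟫ - ⟪v, F v⟫))) := h1.sub ((hx (F v)).sub_const _)
    have h3 : 0 - (⟪x, F v⟫ - ⟪v, F v⟫) = ⟪F v, v - x⟫ := by
      rw [inner_sub_right, real_inner_comm x, real_inner_comm v]; ring
    rw [h3] at h2
    refine ge_of_tendsto' h2 fun t => ?_
    have h4 := hF (u t) v
    rw [inner_sub_left, inner_sub_right (F v), real_inner_comm (u t) (F v)] at h4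
    exact h4.trans (le_of_eq (by simp [real_inner_comm]))
  -- Minty's trick: `v = x + τ • z`, division by `τ > 0`, then `τ → 0`.
  have hdir : ∀ z, 0 ≤ ⟪F x, z⟫ := by
    intro z
    refine ge_of_tendsto ((hh x z z).mono_left (nhdsWithin_le_nhds (s := Ioi 0))) ?_
    filter_upwards [self_mem_nhdsWithin] with τ hτ
    have h1 := hvar (x + τ • z)
    rw [add_sub_cancel_left, inner_smul_right] at h1
    exact nonneg_of_mul_nonneg_right h1 hτ
  have h := hdir (-F x)
  rw [inner_neg_right, real_inner_self_eq_norm_sq] at h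
  have : ‖F x‖ ^ 2 = 0 := le_antisymm (by linarith) (sq_nonneg _)
  simpa using this

variable [CompleteSpace H]

/-- Bounded functions have weak limits along ultrafilters. -/
theorem exists_weak_limit {α : Type*} (U : Ultrafilter α) {u : α → H} {M : ℝ}
    (hM : ∀ᶠ t in U, ‖u t‖ ≤ M) : ∃ x, ∀ z, Tendsto (fun t => ⟪u t, z⟫) U (𝓝 ⟪x, z⟫) := by
  set f : α → WeakDual ℝ H := fun t => StrongDual.toWeakDual (InnerProductSpace.toDual ℝ H (u t))
  have hK := WeakDual.isCompact_closedBall (𝕜 := ℝ) (E := H) 0 M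
  obtain ⟨g, -, hg⟩ := hK.ultrafilter_le_nhds (U.map f) (by
    rw [le_principal_iff]
    refine Filter.mem_map.2 ?_
    filter_upwards [hM] with t ht
    simpa [f] using ht)
  refine ⟨(InnerProductSpace.toDual ℝ H).symm (WeakDual.toStrongDual g), fun z => ?_⟩
  have hg : Tendsto f U (𝓝 g) := hg
  have h := (WeakDual.eval_continuous z).tendsto g |>.comp hg
  rw [InnerProductSpace.toDual_symm_apply]
  exact h

/-- If `F(u) + ε u = o(ε)` with `ε → 0` along bounded `u`, then `u` tends to the minimal norm zero
of `F`. -/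
theorem tendsto_minimalNormZero (hF : IsMonotone F) (hh : IsHemicontinuous F)
    {y : H} (hy : IsMinimalNormZero F y) (hpos : ∀ t, 0 < ε t) (hzero : Tendsto ε atTop (𝓝 0))
    {M : ℝ} (hM : ∀ t, 0 ≤ t → ‖u t‖ ≤ M)
    (hΦ : ∀ η > 0, ∀ᶠ t in atTop, ‖Phi F ε t (u t)‖ ≤ η * ε t) : Tendsto u atTop (𝓝 y) := by
  have hM0 : 0 ≤ M := (norm_nonneg _).trans (hM 0 le_rfl)
  have hMev : ∀ᶠ t in atTop, ‖u t‖ ≤ M := (eventually_ge_atTop 0).mono hM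
  have hFu : Tendsto (fun t => F (u t)) atTop (𝓝 0) := by
    refine squeeze_zero_norm' (a := fun t => (1 + M) * ε t) ?_ (by simpa using hzero.const_mul (1 + M))
    filter_upwards [hΦ 1 one_pos, hMev] with t h1 h2
    have e : F (u t) = -(Phi F ε t (u t) + ε t • u t) := by simp [Phi]
    have h3 := norm_add_le (Phi F ε t (u t)) (ε t • u t)
    rw [norm_smul, Real.norm_of_nonneg (hpos t).le] at h3
    rw [e, norm_neg]
    nlinarith [mul_le_mul_of_nonneg_left h2 (hpos t).le]
  -- Monotonicity against a zero `z` gives `ε * ⟪u, u - z⟫ ≤ ‖Phi‖ * ‖u - z‖`, and the right side is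
  -- `o(ε)`.
  have hineq : ∀ z, F z = 0 → ∀ η > 0, ∀ᶠ t in atTop, ⟪u t, u t - z⟫ < η := by
    intro z hz η hη
    set η' := η / (2 * (M + ‖z‖ + 1)) with hη'
    have hη'0 : 0 < η' := by positivity
    filter_upwards [hΦ η' hη'0, hMev] with t h1 h2
    have hεt := hpos t
    have e : F (u t) - F z = -Phi F ε t (u t) - ε t • u t := by simp [Phi, hz]
    have h3 := hF (u t) z
    rw [e, inner_sub_left, inner_neg_left, inner_smul_left, RCLike.conj_to_real] at h3
    have h4 := (abs_le.1 (abs_real_inner_le_norm (Phi F ε t (u t)) (u t - z))).1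
    have h5 : ‖u t - z‖ ≤ M + ‖z‖ := (norm_sub_le _ _).trans (by gcongr)
    have h6 : ‖Phi F ε t (u t)‖ * ‖u t - z‖ ≤ η' * ε t * (M + ‖z‖) := by gcongr
    have h7 : η' * (M + ‖z‖) < η := by
      have : η' * (2 * (M + ‖z‖ + 1)) = η := by rw [hη']; field_simp
      nlinarith [norm_nonneg z]
    have h8 : ε t * ⟪u t, u t - z⟫ < ε t * η := by nlinarith
    exact lt_of_mul_lt_mul_left h8 hεt.le
  -- Every ultrafilter at infinity has a weak limit of `u`, without extracting subsequences; each is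
  -- shown to be `y`.
  refine (tendsto_iff_ultrafilter _ _ _).2 fun U hU => ?_
  obtain ⟨x, hx⟩ := exists_weak_limit U (hU hMev)
  have hFx := hF.eq_zero_of_weak_limit hh (hU hMev) hx (hFu.mono_left hU)
  have hux : Tendsto u U (𝓝 x) := by
    rw [tendsto_iff_norm_sub_tendsto_zero]
    have hsq : Tendsto (fun t => ‖u t - x‖ ^ 2) U (𝓝 0) := by
      have h1 : Tendsto (fun t => ‖x‖ ^ 2 - ⟪u t, x⟫) U (𝓝 0) := by
        have h := (hx x).const_sub (‖x‖ ^ 2)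
        rwa [real_inner_self_eq_norm_sq, sub_self] at h
      refine tendsto_order.2 ⟨fun a ha => Eventually.of_forall fun t => ha.trans_le (sq_nonneg _),
        fun η hη => ?_⟩
      filter_upwards [h1.eventually_lt_const (half_pos hη), hU (hineq x hFx _ (half_pos hη))]
        with t h2 h3
      rw [norm_sub_sq_real]
      rw [inner_sub_right, real_inner_self_eq_norm_sq] at h3
      linarith
    simpa using hsq.sqrt
  have hxy : ⟪x, x - y⟫ ≤ 0 := by
    refine le_of_forall_pos_le_add fun η hη => ?_
    have h1 : Tendsto (fun t => ⟪u t, u t - y⟫) U (𝓝 ⟪x, x - y⟫) := hux.inner (hux.sub_const y)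
    rw [zero_add]
    have h2 : ∀ᶠ t in (U : Filter ℝ), ⟪u t, u t - y⟫ < η := hU (hineq y hy.1 η hη)
    exact le_of_tendsto h1 (h2.mono fun _ => le_of_lt)
  have hn := hy.2 x hFx
  -- From `‖x‖ ^ 2 ≤ ⟪x, y⟫` one gets `‖x - y‖ ^ 2 ≤ ‖y‖ ^ 2 - ‖x‖ ^ 2`, and `y` has minimal norm.
  have hdist : ‖x - y‖ ^ 2 ≤ 0 := by
    rw [inner_sub_right, real_inner_self_eq_norm_sq] at hxy
    rw [norm_sub_sq_real]
    nlinarith [norm_nonneg y, norm_nonneg x]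
  have : x = y := by
    have h0 : ‖x - y‖ = 0 := pow_eq_zero_iff two_ne_zero |>.1 (le_antisymm hdist (sq_nonneg _))
    exact sub_eq_zero.1 (norm_eq_zero.1 h0)
  exact this ▸ hux

end Convergence

section Extension

variable {H : Type*} [NormedAddCommGroup H] [InnerProductSpace ℝ H] {Φ Ψ : ℝ → H → H}
  {u v : ℝ → H} {T : ℝ}

theorem IsSolutionOn.isRightSolution {u₀ : H} {J : Set ℝ} (hu : IsSolutionOn Φ u₀ J u)
    (hJ : Icc 0 T ⊆ J) (hΦ : ∀ t, 0 ≤ t → Φ t = Ψ t) : IsRightSolution Ψ 0 T u := by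
  refine ⟨hu.continuousOn.mono hJ, fun t ht z => ?_⟩
  rw [← hΦ t ht.1]
  exact (hu.weakDeriv t (hJ (Ico_subset_Icc_self ht)) z).mono_of_mem_nhdsWithin
    (mem_of_superset (Icc_mem_nhdsGE ht.2) ((Icc_subset_Icc_left ht.1).trans hJ))

end Extension

end DSM

theorem claim4p8 {H : Type*} [NormedAddCommGroup H] [InnerProductSpace ℝ H] [CompleteSpace H]
    (F : H → H) (hmono : DSM.IsMonotone F) (hhemi : DSM.IsHemicontinuous F)
    (y : H) (hy : DSM.IsMinimalNormZero F y)
    (ε : ℝ → ℝ) (hpos : ∀ t, 0 ≤ t → 0 < ε t)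
    (hcont : ContinuousOn ε (Ici 0)) (hanti : AntitoneOn ε (Ici 0))
    (hdiff : DifferentiableOn ℝ ε (Ioi 0))
    (hzero : Tendsto ε atTop (𝓝 0))
    (hrate : Tendsto (fun t => deriv ε t / ε t ^ 2) atTop (𝓝 0))
    (u₀ : H) :
    ∃ u : ℝ → H,
      -- a global solution, with the equation at every time in the weak sense
      DSM.IsSolutionOn (DSM.Phi F ε) u₀ (Ici 0) u ∧
      -- the equation also holds in norm: from the right at every time, and almost everywhere
      (∀ t, 0 ≤ t → HasDerivWithinAt u (DSM.Phi F ε t (u t)) (Ici t) t) ∧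
      (∀ᵐ t ∂(volume.restrict (Ici (0 : ℝ))), HasDerivAt u (DSM.Phi F ε t (u t)) t) ∧
      -- every local solution is a restriction of this one
      (∀ T, 0 < T → ∀ v : ℝ → H,
        DSM.IsSolutionOn (DSM.Phi F ε) u₀ (Ico 0 T) v → EqOn v u (Ico 0 T)) ∧
      -- the limit at infinity exists and is the minimal norm zero
      Tendsto u atTop (𝓝 y) := by
  -- Constant extension to negative times keeps positivity, continuity and monotonicity on the whole
  -- line; derivatives are only compared at `t > 0`.
  set e : ℝ → ℝ := fun t => ε (max t 0) with he
  have hec : Continuous e := hcont.comp_continuous (by fun_prop) fun t => le_max_right t 0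
  have hepos : ∀ t, 0 < e t := fun t => hpos _ (le_max_right t 0)
  have heanti : Antitone e := fun s t hst =>
    hanti (le_max_right s 0) (le_max_right t 0) (max_le_max_right 0 hst)
  have heeq : ∀ t, 0 ≤ t → e t = ε t := fun t ht => by simp [e, ht]
  have hegerm : ∀ t, 0 < t → e =ᶠ[𝓝 t] ε := fun t ht =>
    (eventually_gt_nhds ht).mono fun s hs => heeq s hs.le
  have hed : ∀ t, 0 < t → DifferentiableAt ℝ e t := fun t ht =>
    (hdiff.differentiableAt (Ioi_mem_nhds ht)).congr_of_eventuallyEq (hegerm t ht)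
  have hezero : Tendsto e atTop (𝓝 0) :=
    hzero.congr' ((eventually_ge_atTop 0).mono fun t ht => (heeq t ht).symm)
  have herate : Tendsto (fun t => deriv e t / e t ^ 2) atTop (𝓝 0) :=
    hrate.congr' ((eventually_gt_atTop 0).mono fun t ht => by
      simp only [(hegerm t ht).deriv_eq, heeq t ht.le])
  have hPhi : ∀ t, 0 ≤ t → DSM.Phi F ε t = DSM.Phi F e t := fun t ht => by
    funext x; simp [DSM.Phi, heeq t ht]
  obtain ⟨u, hu0, hu⟩ := hmono.exists_global_solution hhemi hec hepos heanti hy.1 u₀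
  set M := ‖u₀ - y‖ + ‖y‖ + 1 + ‖y‖ with hMdef
  have hM : ∀ t, 0 ≤ t → ‖u t‖ ≤ M := fun t ht => by
    have h1 := (hu t).norm_sub_zero_le hmono hepos hy.1 (R := ‖u₀ - y‖ + ‖y‖ + 1)
      (by linarith [norm_nonneg (u₀ - y)]) (by rw [hu0]; linarith [norm_nonneg y]) t
      (right_mem_Icc.2 ht)
    linarith [norm_le_norm_add_norm_sub' (u t) y]
  refine ⟨u, ⟨DSM.continuousOn_Ici_of_forall_isRightSolution hu, hu0, fun t ht z => ?_⟩,
    fun t ht => ?_, ?_, fun T _ v hv t ht => ?_, ?_⟩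
  · rw [hPhi t ht]
    exact DSM.hasDerivWithinAt_inner_of_isRightSolution (hmono.continuous_inner_Phi hhemi hec)
      hu ht z
  · rw [hPhi t ht]
    exact (hu (t + 1)).hasDerivWithinAt_Ici (fun τ _ => hmono.Phi_dissipative (hepos τ).le)
      (DSM.continuous_Phi_time hec) ⟨ht, by linarith⟩
  · have hnull := (DSM.countable_not_hasDerivAt hmono hhemi hec (fun t => (hepos t).le) heanti hu
      hM).ae_notMem volume
    have h0 : ∀ᵐ t : ℝ ∂volume, t ∉ ({0} : Set ℝ) := (countable_singleton 0).ae_notMem volume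
    rw [ae_restrict_iff' measurableSet_Ici]
    filter_upwards [hnull, h0] with t h1 h2 h3
    have ht0 : 0 < t := lt_of_le_of_ne h3 fun h => h2 h.symm
    rw [hPhi t h3]
    by_contra hn
    exact h1 ⟨ht0, hn⟩
  · have hv' := hv.isRightSolution (Ψ := DSM.Phi F e) (T := t)
      (fun s hs => ⟨hs.1, hs.2.trans_lt ht.2⟩) hPhi
    exact hv'.eqOn (hu t) (fun s _ => hmono.Phi_dissipative (hepos s).le)
      (hv.initial.trans hu0.symm) (right_mem_Icc.2 ht.1)
  · exact DSM.tendsto_minimalNormZero hmono hhemi hy hepos hezero hM fun η hη =>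
      DSM.eventually_norm_Phi_le hmono hec hepos heanti hed hezero herate hu hM hη
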